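/- Let $\Gamma=PSL(2,\mathbb Z)=SL(2,\mathbb Z)/\{\pm1\}$, with generators $\mathbb X=\pm\begin{pmatrix}-1&1\\-1&0\end{pmatrix}$ and $\mathbb Y=\pm\begin{pmatrix}0&-1\\1&0\end{pmatrix}$, so that $\mathbb X^3=\mathbb Y^2=1$, and let $[\![\mathbb X\mathbb Y]\!]$ be the conjugacy class of $\mathbb X\mathbb Y$ in $\Gamma$. A generalized $(3,1)$-ribbon graph is a (possibly infinite) set $E$ of edge ends with maps $\mathrm{op},\mathrm{nx}\colon E\to E$ such that $\mathrm{op}^2=\mathrm{id}$ and $\mathrm{nx}^3=\mathrm{id}$. It is a skeleton if $E\neq\varnothing$ and the action of $\Gamma$ on $E$ given by $\mathbb X\mapsto\mathrm{nx}^{-1}$, $\mathbb Y\mapsto\mathrm{op}$ is transitive. Orbits of $\mathrm{op}$ are edges, orbits of $\mathrm{nx}$ are $\bullet$-vertices; a fixed point of $\mathrm{nx}$ is a monovalent $\bullet$-vertex, and a fixed point of $\mathrm{op}$ is a hanging edge, i.e. a monovalent $\circ$-vertex. For a subgroup $H\subset\Gamma$, the set $\Gamma/H$ of left cosets with the left action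 of $\Gamma$ is a skeleton. An admissible tree is a finite tree embedded in the oriented sphere $S^2$ (equivalently, with a cyclic order of the edge ends at each vertex) all of whose vertices have valency $3$ (nodes) or $1$ (leaves). An admissible pair $(T,\ell)$ is an admissible tree $T$ with a function $\ell$ from the set of leaves of $T$ to $\{0,\circ,\bullet,\triangle\}$ such that no two distinct leaves $v_1,v_2$ with $\ell(v_1)=\ell(v_2)=\triangle$ are adjacent to the same node. Its skeleton $\mathrm{Sk}_{(T,\ell)}$ is obtained from $T$ by attaching a small loop to each leaf $v$ with $\ell(v)=0$, making each leaf $v$ with $\ell(v)\in\{\circ,\bullet\}$ a monovalent vertex of type $\ell(v)$, and extending each leaf $v$ with $\ell(v)=\triangle$ to an infinite branch, i.e. making it the root of an infinite binary tree, so that it and all further vertices of the branch are trivalent. A generalized pseudo-tree is a skeleton isomorphic to some $\mathrm{Sk}_{(T,\ell)}$. **Proposition.** Let $H\subset\Gamma$ be a proper finitely generated subgroup. Then $H$ is generated by $H\cap[\![\mathbb X\mathbb Y]\!]$ if and only if $\Gamma/H$ is a generalized pseudo-tree without monovalent vertices. The latter condition holds if and only if $\Gamma/H$ is isomorphic to $\mathrm{Sk}_{(T,\ell)}$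 for an admissible pair $(T,\ell)$ with $\ell$ taking values in $\{0,\triangle\}$. If this is the case, $H$ admits a free basis consisting of elements conjugate to $\mathbb X\mathbb Y$ in $\Gamma$. -/

import Mathlib

/-! ## The modular group -/

/-- The modular group `PSL(2, ℤ) = SL(2, ℤ) / {± 1}`. -/
abbrev ModularGrp : Type := Matrix.ProjectiveSpecialLinearGroup (Fin 2) ℤ

namespace ModularGrp

/-- The quotient homomorphism `SL(2, ℤ) → PSL(2, ℤ)`. -/
def proj : Matrix.SpecialLinearGroup (Fin 2) ℤ →* ModularGrp :=
  QuotientGroup.mk' _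

/-- The matrix of the generator `𝕏`. -/
def matX : Matrix.SpecialLinearGroup (Fin 2) ℤ :=
  ⟨!![-1, 1; -1, 0], by simp [Matrix.det_fin_two]⟩

/-- The matrix of the generator `𝕐`. -/
def matY : Matrix.SpecialLinearGroup (Fin 2) ℤ :=
  ⟨!![0, -1; 1, 0], by simp [Matrix.det_fin_two]⟩

/-- The generator `𝕏` of order three. -/
def X : ModularGrp := proj matX

/-- The generator `𝕐` of order two. -/
def Y : ModularGrp := proj matY

theorem X_mul_X_mul_X : X * (X * X) = 1 := by
  have h : matX * (matX * matX) = 1 := by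
    decide
  rw [X, ← map_mul, ← map_mul, h, map_one]

theorem Y_mul_Y : Y * Y = 1 := by
  have h : matY * matY = -1 := by
    decide
  rw [Y, ← map_mul, h]
  refine (QuotientGroup.eq_one_iff _).2 ?_
  rw [Subgroup.mem_center_iff]
  intro g
  simp

end ModularGrp

/-! ## Ribbon graphs and skeletons -/

/-- A generalized (possibly infinite) `(3,1)`-ribbon graph: a set `E` of edge ends with an
automorphism `op` with `op² = id` (other end of the same edge; its orbits are the edges, a fixed
point is a hanging edge, i.e. a monovalent `○`-vertex) and an automorphism `nx` with `nx³ = id`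
(next end at the same vertex; its orbits are the `●`-vertices). -/
structure RibbonGraph31 where
  E : Type
  op : E → E
  nx : E → E
  op_op : ∀ e, op (op e) = e
  nx_nx_nx : ∀ e, nx (nx (nx e)) = e

namespace RibbonGraph31

/-- Isomorphisms of ribbon graphs: bijections of the sets of ends commuting with `op` and `nx`. -/
structure Iso (S S' : RibbonGraph31) where
  toEquiv : S.E ≃ S'.E
  map_op : ∀ e, toEquiv (S.op e) = S'.op (toEquiv e)
  map_nx : ∀ e, toEquiv (S.nx e) = S'.nx (toEquiv e)

/-- A (generalized) `(3,1)`-skeleton is a connected ribbon graph: it is non-empty and any two ends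
are related by a word in `op` and `nx` (which is transitivity of the canonical action of the modular
group, since `nx⁻¹ = nx²` and `op⁻¹ = op`). -/
def IsSkeleton (S : RibbonGraph31) : Prop :=
  Nonempty S.E ∧
    ∀ e e' : S.E, Relation.ReflTransGen (fun a b => b = S.op a ∨ b = S.nx a) e e'

/-- No monovalent vertices: neither a monovalent `○`-vertex (fixed point of `op`) nor a monovalent
`●`-vertex (fixed point of `nx`). -/
def NoMonovalent (S : RibbonGraph31) : Prop :=
  ∀ e : S.E, S.op e ≠ e ∧ S.nx e ≠ e

end RibbonGraph31

/-- The skeleton `Γ/H` of a subgroup `H` of `Γ = PSL(2, ℤ)`: its ends are the left cosets of `H`, and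
the left action of `Γ` is given by `𝕐 ↦ op`, `𝕏 ↦ nx⁻¹`. -/
def cosetSkeleton (H : Subgroup ModularGrp) : RibbonGraph31 where
  E := ModularGrp ⧸ H
  op e := ModularGrp.Y • e
  nx e := ModularGrp.X⁻¹ • e
  op_op e := by rw [smul_smul, ModularGrp.Y_mul_Y, one_smul]
  nx_nx_nx e := by
    rw [smul_smul, smul_smul, ← mul_inv_rev, ← mul_inv_rev, ModularGrp.X_mul_X_mul_X,
      inv_one, one_smul]

/-! ## Admissible trees and admissible pairs -/

/-- An admissible tree: a finite tree all of whose vertices have valency `3` (nodes) or `1` (leaves),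
embedded in the oriented sphere. Up to orientation preserving homeomorphism, the embedding is the
same as a cyclic order on the edge ends at each vertex, given by the permutation `rot` of the darts:
it sends the end of an edge at a vertex to the next end at that vertex. -/
structure AdmissibleTree where
  V : Type
  finite : Finite V
  graph : SimpleGraph V
  isTree : graph.IsTree
  valency : ∀ v, (graph.neighborSet v).ncard = 3 ∨ (graph.neighborSet v).ncard = 1
  rot : Equiv.Perm graph.Dart
  rot_cycle : ∀ v, rot.IsCycleOn {d | d.fst = v}

namespace AdmissibleTree

/-- A leaf is a vertex of valency one. -/
def IsLeaf (T : AdmissibleTree) (v : T.V) : Prop := (T.graph.neighborSet v).ncard = 1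

theorem rot_fst (T : AdmissibleTree) (d : T.graph.Dart) : (T.rot d).fst = d.fst :=
  (T.rot_cycle d.fst).1.mapsTo rfl

theorem rot_rot_rot (T : AdmissibleTree) (d : T.graph.Dart) (h : ¬ T.IsLeaf d.fst) :
    T.rot (T.rot (T.rot d)) = d := by
  classical
  have := T.finite
  have := Fintype.ofFinite T.V
  have h3 : (T.graph.neighborSet d.fst).ncard = 3 := (T.valency d.fst).resolve_right h
  let s : Finset T.graph.Dart := Finset.univ.filter fun d' => d'.fst = d.fst
  have hs : T.rot.IsCycleOn (s : Set T.graph.Dart) := by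
    simpa [s] using T.rot_cycle d.fst
  have hc : s.card = 3 := by
    have := T.graph.dart_fst_fiber_card_eq_degree d.fst
    rw [← SimpleGraph.card_neighborSet_eq_degree, ← Nat.card_eq_fintype_card,
      Nat.card_coe_set_eq, h3] at this
    exact this
  have := hs.pow_card_apply (a := d) (by simp [s])
  rw [hc] at this
  simpa [pow_succ] using this

end AdmissibleTree

/-- The values of an admissible function on the leaves of an admissible tree. -/
inductive LeafType
  | zero
  | white
  | black
  | triangle

/-- An admissible pair `(T, ℓ)`: an admissible tree with a function `ℓ` from the set of its leaves to
`{0, ○, ●, △}` such that no two `△`-leaves are adjacent to the same node. -/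
structure AdmissiblePair where
  tree : AdmissibleTree
  ell : {v : tree.V // tree.IsLeaf v} → LeafType
  admissible : ∀ v₁ v₂, v₁ ≠ v₂ → ell v₁ = LeafType.triangle → ell v₂ = LeafType.triangle →
    ¬ ∃ u, tree.graph.Adj u v₁ ∧ tree.graph.Adj u v₂

namespace AdmissiblePair

open Classical in
/-- The value of `ℓ` at the vertex of the dart `d`, if this vertex is a leaf; `none` if it is a
node. There is exactly one dart at each leaf. -/
noncomputable def typ (P : AdmissiblePair) (d : P.tree.graph.Dart) : Option LeafType :=
  if h : P.tree.IsLeaf d.fst then some (P.ell ⟨d.fst, h⟩) else none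

theorem typ_eq_none {P : AdmissiblePair} {d : P.tree.graph.Dart} :
    P.typ d = none ↔ ¬ P.tree.IsLeaf d.fst := by
  unfold typ; split_ifs with h <;> simp [h]

theorem typ_rot {P : AdmissiblePair} {d : P.tree.graph.Dart} (h : P.typ d = none) :
    P.typ (P.tree.rot d) = none := by
  rw [typ_eq_none] at h ⊢
  rwa [P.tree.rot_fst]

/-- The edge ends of the skeleton of an admissible pair.
* `edge d`: the ends of the edges of the tree, except those at the `○`-leaves (an edge ending at a
  monovalent `○`-vertex has just one end).
* `loop d b`: the two ends of the small loop attached to the leaf with dart `d`, if its type is `0`.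
* `down d w b`, `up d w b`: the ends of the edges of the infinite branch growing at the leaf with
  dart `d`, if its type is `△`. The vertices of this branch are the finite binary words `w`, the leaf
  itself being the empty word; the two children of `w` are `b :: w`. The edge from `w` to `b :: w`
  has the end `down d w b` at `w` and the end `up d w b` at `b :: w`. -/
inductive End (P : AdmissiblePair) : Type
  | edge (d : P.tree.graph.Dart) (h : P.typ d ≠ some LeafType.white)
  | loop (d : P.tree.graph.Dart) (h : P.typ d = some LeafType.zero) (b : Bool)
  | down (d : P.tree.graph.Dart) (h : P.typ d = some LeafType.triangle) (w : List Bool) (b : Bool)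
  | up (d : P.tree.graph.Dart) (h : P.typ d = some LeafType.triangle) (w : List Bool) (b : Bool)

open Classical in
/-- The other end of the same edge. -/
noncomputable def op (P : AdmissiblePair) : P.End → P.End
  | .edge d h => if h' : P.typ d.symm = some LeafType.white then .edge d h else .edge d.symm h'
  | .loop d h b => .loop d h (!b)
  | .down d h w b => .up d h w b
  | .up d h w b => .down d h w b

/-- The next end at the same vertex. At a node, this is given by the cyclic order of the tree. A leaf
of type `●` is a monovalent vertex. At a leaf of type `0`, the ends are, in this cyclic order, the
end of the tree and the two ends of the loop. At a vertex of an infinite branch, the ends are, in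
this cyclic order, the one of the edge towards the root (at the root: the end of the tree) and those
of the two edges to the children. -/
noncomputable def nx (P : AdmissiblePair) : P.End → P.End
  | .edge d h =>
    match h' : P.typ d with
    | none => .edge (P.tree.rot d) (by simp [typ_rot h'])
    | some .zero => .loop d h' false
    | some .white => absurd h' h
    | some .black => .edge d h
    | some .triangle => .down d h' [] false
  | .loop d h false => .loop d h true
  | .loop d h true => .edge d (by simp [h])
  | .down d h w false => .down d h w true
  | .down d h [] true => .edge d (by simp [h])
  | .down d h (c :: w) true => .up d h w c
  | .up d h w b => .down d h (b :: w) false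

theorem nx_node (P : AdmissiblePair) (d h) (h' : P.typ d = none) :
    P.nx (.edge d h) = .edge (P.tree.rot d) (by simp [typ_rot h']) := by
  simp only [nx]; split <;> first | rfl | (rename_i h2; rw [h'] at h2; cases h2)

theorem nx_zero (P : AdmissiblePair) (d h) (h' : P.typ d = some .zero) :
    P.nx (.edge d h) = .loop d h' false := by
  simp only [nx]; split <;> first | rfl | (rename_i h2; rw [h'] at h2; cases h2)

theorem nx_black (P : AdmissiblePair) (d h) (h' : P.typ d = some .black) :
    P.nx (.edge d h) = .edge d h := by
  simp only [nx]; split <;> first | rfl | (rename_i h2; rw [h'] at h2; cases h2)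

theorem nx_triangle (P : AdmissiblePair) (d h) (h' : P.typ d = some .triangle) :
    P.nx (.edge d h) = .down d h' [] false := by
  simp only [nx]; split <;> first | rfl | (rename_i h2; rw [h'] at h2; cases h2)

/-- The skeleton `Sk_(T, ℓ)` of an admissible pair `(T, ℓ)`. Each leaf of type `0` gets a small loop,
each leaf of type `○` or `●` becomes a monovalent vertex of this type, and each leaf of type `△` is
extended to an infinite branch (a half of the Farey tree). -/
noncomputable def skeleton (P : AdmissiblePair) : RibbonGraph31 where
  E := P.End
  op := P.op
  nx := P.nx
  op_op e := by
    rcases e with ⟨d, h⟩ | ⟨d, h, b⟩ | ⟨d, h, w, b⟩ | ⟨d, h, w, b⟩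
    · by_cases h' : P.typ d.symm = some LeafType.white
      · simp [op, h']
      · simp [op, h', h]
    all_goals simp [op]
  nx_nx_nx e := by
    rcases e with ⟨d, h⟩ | ⟨d, h, b⟩ | ⟨d, h, w, b⟩ | ⟨d, h, w, b⟩
    · match h' : P.typ d with
      | none =>
        rw [nx_node P d h h', nx_node P _ _ (typ_rot h'), nx_node P _ _ (typ_rot (typ_rot h'))]
        simp [P.tree.rot_rot_rot d (typ_eq_none.1 h')]
      | some .zero => rw [nx_zero P d h h']; rfl
      | some .white => exact absurd h' h
      | some .black => rw [nx_black P d h h', nx_black P d h h', nx_black P d h h']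
      | some .triangle => rw [nx_triangle P d h h']; rfl
    · cases b
      · change P.nx (.edge d _) = _
        rw [nx_zero P d _ h]
      · change P.nx (P.nx (.edge d _)) = _
        rw [nx_zero P d _ h]; rfl
    · cases b <;> cases w
      · change P.nx (.edge d _) = _
        rw [nx_triangle P d _ h]
      · rfl
      · change P.nx (P.nx (.edge d _)) = _
        rw [nx_triangle P d _ h]; rfl
      · rfl
    · rfl

end AdmissiblePair

/-- A generalized pseudo-tree is a skeleton isomorphic to `Sk_(T, ℓ)` for some admissible pair. -/
def RibbonGraph31.IsGeneralizedPseudoTree (S : RibbonGraph31) : Prop :=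
  S.IsSkeleton ∧ ∃ P : AdmissiblePair, Nonempty (S.Iso P.skeleton)

/-! By ping-pong, Γ is the free product of ⟨𝕏⟩ of order 3 and ⟨𝕐⟩ of order 2, so every ribbon graph
carries a Γ-action (`exists_hom`, `exists_action`). The element g⁻¹(𝕐𝕏)g lies in H exactly when the
coset of g is an end e with op e = nx² e, i.e. when its edge is a loop bounding a monogon. If such
elements generate H, then a morphism S → Γ/H along which the corresponding monogons lift has a
section through any point over the coset of 1, because H fixes that point (`exists_section`). This
plays the role of simple connectedness of Γ/H with its monogons filled in.

In the forward direction this principle is used three times. The double covering twisted along an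
edge outside the chosen monogons has a section, so that edge separates the graph. A triple covering
twisted at a monovalent ●-vertex cannot have one, so there is no such vertex. Hence Γ/H is a tree
with loops attached, and finite generation makes the loops finite in number (`isLoopedTree`). A
finite subtree containing all loops is a hull; outside it there are only infinite binary branches,
and pruning pairs of sibling leaves without loops yields the admissibility condition
(`exists_reduced_isHull`). Finally, the skeleton of the resulting pair maps onto Γ/H and all
monogons lift to it. The section of this map is the isomorphism, so injectivity of the map need not
be proved by hand.

For the converse, cut the loops. What remains develops into Γ, by means of a potential on the finite
tree (`exists_developing`). Let F be the free group on the loops. A covering of Γ/H with voltages in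
F gives a homomorphism H → F that is a left inverse of the map F → H sending each loop to its
conjugate of 𝕐𝕏, and Schreier's argument shows that the latter map is onto
(`exists_freeGroupBasis`). This gives both the generation statement and the free basis. Absence of
monovalent vertices is translated into values in {0, △} by `isPlain_of_noMonovalent` and
`IsPlain.noMonovalent`. -/

/-! ## The modular group as a free product -/

namespace ModularGrp

open scoped Pointwise

/-- The congruence action of the modular group on `2 × 2`-matrices, `g • M = g M gᵀ`. -/
def congruence : ModularGrp →* Function.End (Matrix (Fin 2) (Fin 2) ℤ) :=
  QuotientGroup.lift _
    { toFun := fun g M => g.1 * M * g.1.transpose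
      map_one' := by funext M; change (1 : Matrix (Fin 2) (Fin 2) ℤ) * M * Matrix.transpose 1 = M; simp
      map_mul' := fun g h => by
        funext M
        change _ = g.1 * (h.1 * M * h.1.transpose) * g.1.transpose
        simp [Matrix.mul_assoc] }
    (by
      intro z hz
      obtain ⟨r, hr, hz⟩ := Matrix.SpecialLinearGroup.mem_center_iff.1 hz
      funext M
      have hr' : r * r = 1 := by simpa [pow_two] using hr
      change z.1 * M * z.1.transpose = M
      rw [← hz]
      ext i j
      rw [Matrix.scalar_apply, Matrix.diagonal_transpose, Matrix.mul_diagonal,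
        Matrix.diagonal_mul]
      linear_combination (M i j) * hr')

theorem congruence_proj (g : Matrix.SpecialLinearGroup (Fin 2) ℤ)
    (M : Matrix (Fin 2) (Fin 2) ℤ) :
    congruence (proj g) M = g.1 * M * g.1.transpose := rfl

/-- The homomorphism from a finite cyclic group given by an element of a group. -/
def cyclicHom {G : Type*} [Group G] (n : ℕ) (x : G) (hx : x ^ n = 1) :
    Multiplicative (ZMod n) →* G :=
  AddMonoidHom.toMultiplicativeLeft (ZMod.lift n ⟨zmultiplesHom (Additive G) (Additive.ofMul x), by
    simp [← ofMul_pow, hx]⟩)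

theorem cyclicHom_one {G : Type*} [Group G] (n : ℕ) (x : G) (hx : x ^ n = 1) :
    cyclicHom n x hx (Multiplicative.ofAdd 1) = x := by
  have := ZMod.lift_coe n ⟨zmultiplesHom (Additive G) (Additive.ofMul x), by
    simp [← ofMul_pow, hx]⟩ 1
  simp only [Int.cast_one] at this
  simp [cyclicHom, this]

theorem X_pow_three : X ^ 3 = 1 := by
  rw [pow_succ, pow_two, mul_assoc, X_mul_X_mul_X]

theorem Y_pow_two : Y ^ 2 = 1 := by
  rw [pow_two, Y_mul_Y]

theorem Y_inv : Y⁻¹ = Y := inv_eq_of_mul_eq_one_left Y_mul_Y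

theorem X_inv : X⁻¹ = X * X := inv_eq_of_mul_eq_one_right X_mul_X_mul_X

theorem closure_X_Y : Subgroup.closure {X, Y} = (⊤ : Subgroup ModularGrp) := by
  have h : Subgroup.closure {ModularGroup.S, ModularGroup.T} = ⊤ :=
    SpecialLinearGroup.SL2Z_generators
  have hS : ModularGroup.S = matY := by decide
  have hT : ModularGroup.T = matX * matY := by decide
  have h2 := congrArg (Subgroup.map proj) h
  rw [MonoidHom.map_closure, Set.image_pair, hS, hT, map_mul,
    Subgroup.map_top_of_surjective proj (QuotientGroup.mk'_surjective _)] at h2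
  rw [eq_top_iff, ← h2, Subgroup.closure_le]
  rintro g (rfl | rfl)
  · exact Subgroup.subset_closure (by right; rfl)
  · exact mul_mem (Subgroup.subset_closure (by left; rfl)) (Subgroup.subset_closure (by right; rfl))

/-- The cyclic groups of order three and two. -/
abbrev Factor (i : Bool) : Type := Multiplicative (ZMod (if i then 3 else 2))

/-- The homomorphisms of the factors to a group given by elements of orders three and two. -/
def factorHom {G : Type*} [Group G] (x y : G) (hx : x ^ 3 = 1) (hy : y ^ 2 = 1) :
    ∀ i, Factor i →* G
  | true => cyclicHom 3 x hx
  | false => cyclicHom 2 y hy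

/-- Ping-pong on symmetric matrices with nonnegative diagonal, split by the sign of the off-diagonal
entry: 𝕐 turns a positive entry into a negative one, while 𝕏 and 𝕏² turn a negative entry into a
positive one. Congruence, unlike multiplication, is insensitive to the sign of a matrix and so is
defined on PSL(2, ℤ). -/
theorem factorHom_lift_injective :
    Function.Injective (Monoid.CoprodI.lift (factorHom X Y X_pow_three Y_pow_two)) := by
  let _ : MulAction ModularGrp (Matrix (Fin 2) (Fin 2) ℤ) := MulAction.compHom _ congruence
  have hsmul : ∀ (g : Matrix.SpecialLinearGroup (Fin 2) ℤ) (M : Matrix (Fin 2) (Fin 2) ℤ),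
    proj g • M = g.1 * M * g.1.transpose := congruence_proj
  let A : Bool → Set (Matrix (Fin 2) (Fin 2) ℤ) := fun i =>
    {M | M 0 1 = M 1 0 ∧ 0 ≤ M 0 0 ∧ 0 ≤ M 1 1 ∧ if i then 0 < M 0 1 else M 0 1 < 0}
  refine Monoid.CoprodI.lift_injective_of_ping_pong _ (Or.inr ⟨true, ?_⟩) A ?_ ?_ ?_
  -- With only two factors, ping-pong needs one of them to have at least three elements.
  · change (3 : Cardinal) ≤ Cardinal.mk (ZMod 3)
    simp
  · rintro (_ | _)
    · exact ⟨!![1, -1; -1, 1], by simp [A]⟩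
    · exact ⟨!![1, 1; 1, 1], by simp [A]⟩
  · rintro (_ | _) (_ | _) h
    · exact absurd rfl h
    · refine Set.disjoint_left.2 fun M h1 h2 => ?_
      simp [A] at h1 h2; omega
    · refine Set.disjoint_left.2 fun M h1 h2 => ?_
      simp [A] at h1 h2; omega
    · exact absurd rfl h
  · have hX : ∀ M ∈ A false, X • M ∈ A true := by
      rintro M ⟨h1, h2, h3, h4⟩
      change proj matX • M ∈ A true
      rw [hsmul]
      simp at h4
      simp [A, matX, Matrix.mul_apply, Fin.sum_univ_two, Matrix.vecMul, Matrix.vecHead,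
        Matrix.vecTail]
      omega
    have hXX : ∀ M ∈ A false, (X * X) • M ∈ A true := by
      rintro M ⟨h1, h2, h3, h4⟩
      change (proj matX * proj matX) • M ∈ A true
      rw [mul_smul, hsmul, hsmul]
      simp at h4
      simp [A, matX, Matrix.mul_apply, Fin.sum_univ_two, Matrix.vecMul, Matrix.vecHead,
        Matrix.vecTail]
      omega
    have hY : ∀ M ∈ A true, Y • M ∈ A false := by
      rintro M ⟨h1, h2, h3, h4⟩
      change proj matY • M ∈ A false
      rw [hsmul]
      simp at h4
      simp [A, matY, Matrix.mul_apply, Fin.sum_univ_two, Matrix.vecMul, Matrix.vecHead,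
        Matrix.vecTail]
      omega
    rintro (_ | _) (_ | _) hij h hh
    · exact absurd rfl hij
    · have h1 : h = Multiplicative.ofAdd 1 := by revert h; decide
      rintro _ ⟨M, hM, rfl⟩
      rw [h1]
      change cyclicHom 2 Y Y_pow_two _ • M ∈ _
      rw [cyclicHom_one]
      exact hY M hM
    · have h1 : h = Multiplicative.ofAdd 1 ∨ h = Multiplicative.ofAdd 1 * Multiplicative.ofAdd 1 := by
        revert h; decide
      rintro _ ⟨M, hM, rfl⟩
      change cyclicHom 3 X X_pow_three h • M ∈ _
      rcases h1 with rfl | rfl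
      · rw [cyclicHom_one]
        exact hX M hM
      · rw [map_mul, cyclicHom_one]
        exact hXX M hM
    · exact absurd rfl hij

theorem factorHom_lift_surjective :
    Function.Surjective (Monoid.CoprodI.lift (factorHom X Y X_pow_three Y_pow_two)) := by
  rw [← MonoidHom.range_eq_top, eq_top_iff, ← closure_X_Y, Subgroup.closure_le]
  rintro g (rfl | rfl)
  · exact ⟨Monoid.CoprodI.of (i := true) (Multiplicative.ofAdd 1), by
      rw [Monoid.CoprodI.lift_of]; exact cyclicHom_one _ _ X_pow_three⟩
  · exact ⟨Monoid.CoprodI.of (i := false) (Multiplicative.ofAdd 1), by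
      rw [Monoid.CoprodI.lift_of]; exact cyclicHom_one _ _ Y_pow_two⟩

/-- The modular group is the free product of cyclic groups of orders three and two. -/
noncomputable def coprodEquiv : Monoid.CoprodI Factor ≃* ModularGrp :=
  MulEquiv.ofBijective _ ⟨factorHom_lift_injective, factorHom_lift_surjective⟩

theorem coprodEquiv_of (i : Bool) (h : Factor i) :
    coprodEquiv (Monoid.CoprodI.of h) = factorHom X Y X_pow_three Y_pow_two i h :=
  Monoid.CoprodI.lift_of _ _

/-- The universal property of the modular group. -/
theorem exists_hom {G : Type*} [Group G] (x y : G) (hx : x ^ 3 = 1) (hy : y ^ 2 = 1) :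
    ∃ f : ModularGrp →* G, f X = x ∧ f Y = y := by
  have key : ∀ (i : Bool) (h : Factor i),
      Monoid.CoprodI.lift (factorHom x y hx hy)
        (coprodEquiv.symm (factorHom X Y X_pow_three Y_pow_two i h)) = factorHom x y hx hy i h := by
    intro i h
    rw [← coprodEquiv_of, MulEquiv.symm_apply_apply, Monoid.CoprodI.lift_of]
  have hX : factorHom X Y X_pow_three Y_pow_two true (Multiplicative.ofAdd 1) = X :=
    cyclicHom_one _ _ X_pow_three
  have hY : factorHom X Y X_pow_three Y_pow_two false (Multiplicative.ofAdd 1) = Y :=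
    cyclicHom_one _ _ Y_pow_two
  refine ⟨(Monoid.CoprodI.lift (factorHom x y hx hy)).comp coprodEquiv.symm.toMonoidHom, ?_, ?_⟩
  · have := key true (Multiplicative.ofAdd 1)
    rw [hX] at this
    exact this.trans (cyclicHom_one _ _ hx)
  · have := key false (Multiplicative.ofAdd 1)
    rw [hY] at this
    exact this.trans (cyclicHom_one _ _ hy)

end ModularGrp

/-! ## The action on the ends of a ribbon graph -/

namespace RibbonGraph31

/-- The permutation of the ends given by `op`. -/
def opPerm (S : RibbonGraph31) : Equiv.Perm S.E := ⟨S.op, S.op, S.op_op, S.op_op⟩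

/-- The permutation of the ends given by `nx`. -/
def nxPerm (S : RibbonGraph31) : Equiv.Perm S.E :=
  ⟨S.nx, fun e => S.nx (S.nx e), S.nx_nx_nx, S.nx_nx_nx⟩

theorem nx_injective (S : RibbonGraph31) : Function.Injective S.nx := S.nxPerm.injective

theorem op_injective (S : RibbonGraph31) : Function.Injective S.op := S.opPerm.injective

theorem exists_action (S : RibbonGraph31) : ∃ f : ModularGrp →* Equiv.Perm S.E,
    (∀ e, f ModularGrp.X e = S.nx (S.nx e)) ∧ ∀ e, f ModularGrp.Y e = S.op e := by
  obtain ⟨f, hX, hY⟩ := ModularGrp.exists_hom (S.nxPerm⁻¹) S.opPerm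
    (by
      rw [inv_pow, inv_eq_one]
      ext e
      exact S.nx_nx_nx e)
    (by
      ext e
      exact S.op_op e)
  exact ⟨f, fun e => by rw [hX]; rfl, fun e => by rw [hY]; rfl⟩

/-- A set of ends is stable if it is preserved by `op` and `nx`. In a connected ribbon graph, there
are no proper nonempty stable sets. -/
def NoProperStable (S : RibbonGraph31) : Prop :=
  ∀ A : Set S.E, A.Nonempty → (∀ e ∈ A, S.op e ∈ A) → (∀ e ∈ A, S.nx e ∈ A) → ∀ e, e ∈ A

theorem NoProperStable.isSkeleton {S : RibbonGraph31} (h : S.NoProperStable)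
    (hne : Nonempty S.E) : S.IsSkeleton := by
  refine ⟨hne, fun e e' => ?_⟩
  exact h {e' | Relation.ReflTransGen (fun a b => b = S.op a ∨ b = S.nx a) e e'}
    ⟨e, Relation.ReflTransGen.refl⟩ (fun a ha => ha.tail (Or.inl rfl))
    (fun a ha => ha.tail (Or.inr rfl)) e'

end RibbonGraph31

/-! ### Coset skeletons and sections of morphisms to them -/

namespace cosetSkeleton

open ModularGrp

/-- The coset of `g` as an end of the skeleton. -/
def coset (H : Subgroup ModularGrp) (g : ModularGrp) : (cosetSkeleton H).E :=
  (QuotientGroup.mk g : ModularGrp ⧸ H)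

theorem coset_surjective (H : Subgroup ModularGrp) : Function.Surjective (coset H) :=
  QuotientGroup.mk_surjective

theorem coset_eq_iff {H : Subgroup ModularGrp} {a b : ModularGrp} :
    coset H a = coset H b ↔ a⁻¹ * b ∈ H := QuotientGroup.eq

theorem op_mk (H : Subgroup ModularGrp) (g : ModularGrp) :
    (cosetSkeleton H).op (coset H g) =
      (coset H (Y * g)) := rfl

theorem nx_mk (H : Subgroup ModularGrp) (g : ModularGrp) :
    (cosetSkeleton H).nx (coset H g) =
      (coset H (X⁻¹ * g)) := rfl

theorem nx_nx_mk (H : Subgroup ModularGrp) (g : ModularGrp) :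
    (cosetSkeleton H).nx ((cosetSkeleton H).nx (coset H g)) =
      (coset H (X * g)) := by
  rw [nx_mk, nx_mk, ← mul_assoc, ← mul_inv_rev, ← X_inv, inv_inv]

theorem noProperStable (H : Subgroup ModularGrp) : (cosetSkeleton H).NoProperStable := by
  intro A ⟨e₀, he₀⟩ hop hnx e
  have hX : ∀ e : ModularGrp ⧸ H, e ∈ A → X • e ∈ A := by
    intro e he
    have := hnx _ (hnx e he)
    change X⁻¹ • X⁻¹ • e ∈ A at this
    rwa [smul_smul, ← mul_inv_rev, ← X_inv, inv_inv] at this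
  have key : ∀ g : ModularGrp, ∀ e : ModularGrp ⧸ H, e ∈ A ↔ g • e ∈ A := by
    intro g
    have hg : g ∈ Subgroup.closure {X, Y} := by rw [closure_X_Y]; trivial
    induction hg using Subgroup.closure_induction with
    | mem g hg =>
      rcases hg with rfl | rfl
      · refine fun e => ⟨hX e, fun h => ?_⟩
        have := hnx _ h
        change X⁻¹ • X • e ∈ A at this
        rwa [inv_smul_smul] at this
      · refine fun e => ⟨hop e, fun h => ?_⟩
        have := hop _ h
        change Y • Y • e ∈ A at this
        rwa [smul_smul, Y_mul_Y, one_smul] at this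
    | one => simp
    | mul g g' _ _ h h' => intro e; rw [h' e, h (g' • e), smul_smul]
    | inv g _ h => intro e; rw [h (g⁻¹ • e), smul_inv_smul]
  obtain ⟨g, hg⟩ := MulAction.exists_smul_eq ModularGrp (α := ModularGrp ⧸ H) e₀ e
  exact hg ▸ (key g e₀).1 he₀

theorem isSkeleton (H : Subgroup ModularGrp) : (cosetSkeleton H).IsSkeleton :=
  (noProperStable H).isSkeleton ⟨(coset H 1)⟩

theorem map_action {H : Subgroup ModularGrp} {S : RibbonGraph31}
    {f : ModularGrp →* Equiv.Perm S.E} (hX : ∀ e, f X e = S.nx (S.nx e)) (hY : ∀ e, f Y e = S.op e)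
    {π : S.E → (cosetSkeleton H).E} (hop : ∀ x, π (S.op x) = (cosetSkeleton H).op (π x))
    (hnx : ∀ x, π (S.nx x) = (cosetSkeleton H).nx (π x)) (g : ModularGrp) :
    ∀ x, ∀ a : ModularGrp, π x = coset H a → π (f g x) = coset H (g * a) := by
  have hg : g ∈ Subgroup.closure {X, Y} := by rw [closure_X_Y]; trivial
  induction hg using Subgroup.closure_induction with
  | mem g hg =>
    rcases hg with rfl | rfl
    · intro x a h
      rw [hX, hnx, hnx, h, nx_nx_mk]
    · intro x a h
      rw [hY, hop, h, op_mk]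
  | one => intro x a h; simpa using h
  | mul g g' _ _ h h' =>
    intro x a ha
    rw [map_mul, Equiv.Perm.mul_apply, h _ _ (h' _ _ ha), mul_assoc]
  | inv g _ h =>
    intro x a ha
    obtain ⟨b, hb⟩ := coset_surjective H (π (f g⁻¹ x))
    have := h _ b hb.symm
    rw [← Equiv.Perm.mul_apply, ← map_mul, mul_inv_cancel, map_one, Equiv.Perm.one_apply, ha]
      at this
    rw [← hb]
    rw [coset_eq_iff] at this ⊢
    simpa [mul_assoc] using inv_mem this

/-- If `H` is generated by conjugates of `𝕐𝕏` such that the corresponding monogons lift along a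
morphism to `Γ/H`, then this morphism has a section. -/
theorem exists_section {H : Subgroup ModularGrp} {t : Set ModularGrp}
    (ht : Subgroup.closure ((fun g => g⁻¹ * (Y * X) * g) '' t) = H) (S : RibbonGraph31)
    (π : S.E → (cosetSkeleton H).E) (hop : ∀ x, π (S.op x) = (cosetSkeleton H).op (π x))
    (hnx : ∀ x, π (S.nx x) = (cosetSkeleton H).nx (π x))
    (hfix : ∀ g ∈ t, ∀ x, π x = (coset H g) →
      S.op x = S.nx (S.nx x))
    (p : S.E) (hp : π p = (coset H 1)) :
    ∃ σ : (cosetSkeleton H).E → S.E, σ (coset H 1) = p ∧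
      (∀ e, σ ((cosetSkeleton H).op e) = S.op (σ e)) ∧
      (∀ e, σ ((cosetSkeleton H).nx e) = S.nx (σ e)) ∧ ∀ e, π (σ e) = e := by
  obtain ⟨f, hX, hY⟩ := S.exists_action
  have hπ := map_action hX hY hop hnx
  -- For a generator g⁻¹(𝕐𝕏)g, the point g·p lies over the coset of g, where the lifted monogon says
  -- that 𝕐𝕏 acts trivially. Once H fixes p, the orbit map g ↦ g·p descends to Γ/H and is the
  -- section.
  have hfixp : ∀ h ∈ H, f h p = p := by
    intro h hh
    rw [← ht] at hh
    induction hh using Subgroup.closure_induction with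
    | mem _ hg =>
      obtain ⟨g, hg, rfl⟩ := hg
      have h1 := hfix g hg (f g p) (by simpa using hπ g p 1 hp)
      have h2 : f (Y * X) (f g p) = f g p := by
        rw [map_mul, Equiv.Perm.mul_apply, hX, hY, ← h1, S.op_op]
      simp only [map_mul, Equiv.Perm.mul_apply, map_inv] at h2 ⊢
      rw [h2]; exact Equiv.symm_apply_apply _ _
    | one => simp
    | mul g g' _ _ h h' => rw [map_mul, Equiv.Perm.mul_apply, h', h]
    | inv g _ h => rw [map_inv, Equiv.Perm.inv_eq_iff_eq, h]
  refine ⟨Quotient.lift (fun g => f g p) ?_, ?_, ?_, ?_, ?_⟩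
  · intro a b hab
    have := hfixp _ (QuotientGroup.leftRel_apply.1 hab)
    change f a p = f b p
    conv_lhs => rw [← this, ← Equiv.Perm.mul_apply, ← map_mul, mul_inv_cancel_left]
  · change f 1 p = p
    simp
  · intro e
    obtain ⟨g, rfl⟩ := coset_surjective H e
    change f (Y * g) p = S.op (f g p)
    rw [map_mul, Equiv.Perm.mul_apply, hY]
  · intro e
    obtain ⟨g, rfl⟩ := coset_surjective H e
    change f (X⁻¹ * g) p = S.nx (f g p)
    rw [map_mul, Equiv.Perm.mul_apply, X_inv, map_mul, Equiv.Perm.mul_apply, hX, hX, S.nx_nx_nx]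
  · intro e
    obtain ⟨g, rfl⟩ := coset_surjective H e
    change π (f g p) = _
    simpa using hπ g p 1 hp

end cosetSkeleton

/-! ## Half-spaces -/

namespace RibbonGraph31

/-- The ends at the same vertex. -/
def vtx (S : RibbonGraph31) (e : S.E) : Set S.E := {e, S.nx e, S.nx (S.nx e)}

theorem mem_vtx_self (S : RibbonGraph31) (e : S.E) : e ∈ S.vtx e := Or.inl rfl

theorem mem_vtx_iff {S : RibbonGraph31} {e x : S.E} :
    x ∈ S.vtx e ↔ x = e ∨ x = S.nx e ∨ x = S.nx (S.nx e) := Iff.rfl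

theorem vtx_nx (S : RibbonGraph31) (e : S.E) : S.vtx (S.nx e) = S.vtx e := by
  ext x
  simp only [mem_vtx_iff, S.nx_nx_nx]
  tauto

theorem vtx_eq_of_mem {S : RibbonGraph31} {e x : S.E} (h : x ∈ S.vtx e) : S.vtx x = S.vtx e := by
  rcases h with rfl | rfl | rfl
  · rfl
  · exact S.vtx_nx e
  · rw [vtx_nx, vtx_nx]

theorem vtx_eq_iff {S : RibbonGraph31} {e x : S.E} : S.vtx x = S.vtx e ↔ x ∈ S.vtx e :=
  ⟨fun h => h ▸ S.mem_vtx_self x, vtx_eq_of_mem⟩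

theorem mem_of_mem_vtx {S : RibbonGraph31} {A : Set S.E} (hA : ∀ x ∈ A, S.nx x ∈ A) {e x : S.E}
    (he : e ∈ A) (hx : x ∈ S.vtx e) : x ∈ A := by
  rcases hx with rfl | rfl | rfl
  · exact he
  · exact hA _ he
  · exact hA _ (hA _ he)

/-- The edge of the end `e` is a loop. -/
def IsLoop (S : RibbonGraph31) (e : S.E) : Prop := S.op e ∈ S.vtx e

theorem IsLoop.op {S : RibbonGraph31} {e : S.E} (h : S.IsLoop e) : S.IsLoop (S.op e) := by
  rw [IsLoop, S.op_op, vtx_eq_of_mem h]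
  exact S.mem_vtx_self e

theorem isLoop_op_iff {S : RibbonGraph31} {e : S.E} : S.IsLoop (S.op e) ↔ S.IsLoop e :=
  ⟨fun h => S.op_op e ▸ h.op, IsLoop.op⟩

/-- A half-space of the end `e`: a set of vertices containing that of `e` and not that of `op e`
such that the edge of `e` is the only one leaving it. -/
structure IsHalfSpace (S : RibbonGraph31) (e : S.E) (A : Set S.E) : Prop where
  mem : e ∈ A
  op_notMem : S.op e ∉ A
  nx_mem : ∀ x ∈ A, S.nx x ∈ A
  op_mem_iff : ∀ x, x ≠ e → x ≠ S.op e → (S.op x ∈ A ↔ x ∈ A)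

/-- A ribbon graph without monovalent vertices that becomes a tree after finitely many loops
are cut. -/
structure IsLoopedTree (S : RibbonGraph31) : Prop where
  nonempty : Nonempty S.E
  noProperStable : S.NoProperStable
  op_ne : ∀ e, S.op e ≠ e
  nx_ne : ∀ e, S.nx e ≠ e
  finite_loops : {e | S.IsLoop e}.Finite
  exists_halfSpace : ∀ e, ¬ S.IsLoop e → ∃ A, S.IsHalfSpace e A

open Classical in
/-- The two-fold covering twisted along the edge of `e`. -/
noncomputable def edgeTwist (S : RibbonGraph31) (e : S.E) : RibbonGraph31 where
  E := S.E × Bool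
  op x := (S.op x.1, if x.1 = e ∨ x.1 = S.op e then !x.2 else x.2)
  nx x := (S.nx x.1, x.2)
  op_op x := by
    have h : (S.op x.1 = e ∨ S.op x.1 = S.op e) ↔ (x.1 = e ∨ x.1 = S.op e) := by
      rw [S.op_injective.eq_iff, or_comm]
      constructor <;> rintro (h | h)
      · exact Or.inl h
      · exact Or.inr (by rw [← h, S.op_op])
      · exact Or.inl h
      · exact Or.inr (by rw [h, S.op_op])
    ext
    · exact S.op_op _
    · by_cases h' : x.1 = e ∨ x.1 = S.op e
      · simp [h, h']
      · simp [h, h']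
  nx_nx_nx x := by simp [S.nx_nx_nx]

open Classical in
/-- The three-fold covering twisted at a monovalent vertex. -/
noncomputable def vertexTwist (S : RibbonGraph31) (e : S.E) (he : S.nx e = e) : RibbonGraph31 where
  E := S.E × ZMod 3
  op x := (S.op x.1, x.2)
  nx x := (S.nx x.1, if x.1 = e then x.2 + 1 else x.2)
  op_op x := by simp [S.op_op]
  nx_nx_nx x := by
    have h : ∀ y, S.nx y = e ↔ y = e := fun y => by
      rw [← S.nx_injective.eq_iff (a := y), he]
    ext
    · exact S.nx_nx_nx _
    · by_cases h' : x.1 = e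
      · simp only [h, h', if_true, add_assoc]
        rw [show (1 : ZMod 3) + (1 + 1) = 0 by decide, add_zero]
      · simp [h, h']

end RibbonGraph31

/-! ### Finite generating subsets -/

namespace Subgroup

theorem exists_finite_subset_of_mem_closure {G : Type*} [Group G] {s : Set G} {x : G}
    (hx : x ∈ closure s) : ∃ t ⊆ s, t.Finite ∧ x ∈ closure t := by
  induction hx using closure_induction with
  | mem x hx => exact ⟨{x}, by simpa using hx, Set.finite_singleton x, subset_closure rfl⟩
  | one => exact ⟨∅, Set.empty_subset _, Set.finite_empty, one_mem _⟩
  | mul x y _ _ hx hy =>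
    obtain ⟨t, ht, htf, hxt⟩ := hx
    obtain ⟨u, hu, huf, hyu⟩ := hy
    exact ⟨t ∪ u, Set.union_subset ht hu, htf.union huf,
      mul_mem (closure_mono Set.subset_union_left hxt) (closure_mono Set.subset_union_right hyu)⟩
  | inv x _ hx =>
    obtain ⟨t, ht, htf, hxt⟩ := hx
    exact ⟨t, ht, htf, inv_mem hxt⟩

/-- Any generating set of a finitely generated subgroup contains a finite generating set. -/
theorem exists_finite_subset_closure_eq {G : Type*} [Group G] {H : Subgroup G} (hfg : H.FG)
    {s : Set G} (hs : closure s = H) : ∃ t ⊆ s, t.Finite ∧ closure t = H := by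
  obtain ⟨u, hu, huf⟩ := (fg_iff H).1 hfg
  have hmem : ∀ x : u, ∃ t ⊆ s, t.Finite ∧ (x : G) ∈ closure t := fun x =>
    exists_finite_subset_of_mem_closure (by rw [hs, ← hu]; exact subset_closure x.2)
  choose t ht htf hxt using hmem
  have := huf.to_subtype
  refine ⟨⋃ x, t x, Set.iUnion_subset ht, Set.finite_iUnion htf, le_antisymm ?_ ?_⟩
  · rw [← hs]
    exact closure_mono (Set.iUnion_subset ht)
  · rw [← hu, closure_le]
    exact fun x hx => closure_mono (Set.subset_iUnion t ⟨x, hx⟩) (hxt ⟨x, hx⟩)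

end Subgroup

/-! ### Γ/H as a tree with loops -/

namespace cosetSkeleton

open ModularGrp RibbonGraph31 Subgroup

variable {H : Subgroup ModularGrp} {t : Set ModularGrp}

theorem op_eq_nx_nx (ht : Subgroup.closure ((fun g => g⁻¹ * (Y * X) * g) '' t) = H)
    {g : ModularGrp} (hg : g ∈ t) :
    (cosetSkeleton H).op (coset H g) =
      (cosetSkeleton H).nx ((cosetSkeleton H).nx (coset H g)) := by
  rw [op_mk, nx_nx_mk]
  refine coset_eq_iff.2 ?_
  rw [← ht]
  have : (Y * g)⁻¹ * (X * g) = g⁻¹ * (Y * X) * g := by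
    rw [mul_inv_rev, Y_inv]; simp only [mul_assoc]
  rw [this]
  exact Subgroup.subset_closure ⟨g, hg, rfl⟩

/-- The twist along the edge of e does not touch the monogons of t, so they lift to the double
covering and a section exists. The sheet chosen by the section changes exactly across the edge of e,
so the ends on the sheet of e form the half-space. -/
theorem exists_halfSpace_of_notMem
    (ht : Subgroup.closure ((fun g => g⁻¹ * (Y * X) * g) '' t) = H) (e : (cosetSkeleton H).E)
    (h1 : ∀ g ∈ t, (coset H g) ≠ e)
    (h2 : ∀ g ∈ t, (coset H g) ≠ (cosetSkeleton H).op e) :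
    ∃ A, (cosetSkeleton H).IsHalfSpace e A := by
  obtain ⟨σ, -, hop, hnx, hπ⟩ := exists_section ht ((cosetSkeleton H).edgeTwist e) Prod.fst
    (fun _ => rfl) (fun _ => rfl)
    (by
      rintro g hg ⟨x, b⟩ rfl
      refine Prod.ext (op_eq_nx_nx ht hg) ?_
      simp only [edgeTwist, h1 g hg, h2 g hg, or_self, if_false])
    ((coset H 1), true) rfl
  have hop' : ∀ x, x ≠ e → x ≠ (cosetSkeleton H).op e →
      (σ ((cosetSkeleton H).op x)).2 = (σ x).2 := by
    intro x hx hx'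
    rw [hop]
    simp only [edgeTwist, hπ, hx, hx', or_self, if_false]
  have hope : (σ ((cosetSkeleton H).op e)).2 = !(σ e).2 := by
    rw [hop]
    simp only [edgeTwist, hπ, true_or, if_true]
  have hnx' : ∀ x, (σ ((cosetSkeleton H).nx x)).2 = (σ x).2 := by
    intro x
    rw [hnx]
    rfl
  refine ⟨{x | (σ x).2 = (σ e).2}, rfl, ?_, ?_, ?_⟩
  · simp [hope]
  · intro x hx
    exact (hnx' x).trans hx
  · intro x hx hx'
    simp only [Set.mem_ofPred_eq, hop' x hx hx']

/-- If nx e = e, a section of the triple covering twisted at e would satisfy b = b + 1 in ℤ/3. The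
monogons of t lift because none of them sits at e: there op e = nx² e = e. -/
theorem nx_ne_of_op_ne (ht : Subgroup.closure ((fun g => g⁻¹ * (Y * X) * g) '' t) = H)
    (hop : ∀ e, (cosetSkeleton H).op e ≠ e) (e : (cosetSkeleton H).E) :
    (cosetSkeleton H).nx e ≠ e := by
  intro he
  have h : ∀ y, (cosetSkeleton H).nx y = e ↔ y = e := fun y => by
    rw [← (cosetSkeleton H).nx_injective.eq_iff (a := y), he]
  obtain ⟨σ, -, -, hnx, hπ⟩ := exists_section ht ((cosetSkeleton H).vertexTwist e he) Prod.fst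
    (fun _ => rfl) (fun _ => rfl)
    (by
      rintro g hg ⟨x, b⟩ rfl
      have hge : (coset H g) ≠ e := by
        rintro rfl
        refine hop (coset H g) ?_
        rw [op_eq_nx_nx ht hg, he, he]
      refine Prod.ext (op_eq_nx_nx ht hg) ?_
      simp only [vertexTwist, h, hge, if_false])
    ((coset H 1), 0) rfl
  have := congrArg Prod.snd (hnx e)
  rw [he] at this
  simp [vertexTwist, hπ] at this

/-- A common fixed point is a stable set by itself, so Γ/H is a single point. -/
theorem eq_top_of_fixed {e : (cosetSkeleton H).E} (h1 : (cosetSkeleton H).op e = e)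
    (h2 : (cosetSkeleton H).nx e = e) : H = ⊤ := by
  have h := noProperStable H {e} ⟨e, rfl⟩ (by rintro _ rfl; exact h1) (by rintro _ rfl; exact h2)
  rw [eq_top_iff]
  intro g _
  have := (h (coset H 1)).trans
    (h (coset H g)).symm
  simpa using coset_eq_iff.1 this

/-- The skeleton of a proper subgroup generated by finitely many conjugates of `𝕐𝕏`. -/
theorem isLoopedTree (htop : H ≠ ⊤) (hfin : t.Finite)
    (ht : Subgroup.closure ((fun g => g⁻¹ * (Y * X) * g) '' t) = H) :
    (cosetSkeleton H).IsLoopedTree := by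
  have hop : ∀ e, (cosetSkeleton H).op e ≠ e := by
    intro e he
    -- If e carries a monogon of t, then nx fixes e too and H would be all of Γ. Otherwise e has a
    -- half-space, which would both contain and omit e = op e.
    by_cases h : ∃ g ∈ t, (coset H g) = e
    · obtain ⟨g, hg, rfl⟩ := h
      have h1 := op_eq_nx_nx ht hg
      refine htop (eq_top_of_fixed he ?_)
      have h2 := congrArg (cosetSkeleton H).nx h1
      rwa [nx_nx_nx, he] at h2
    · push Not at h
      obtain ⟨A, hA⟩ := exists_halfSpace_of_notMem ht e h (by rw [he]; exact h)
      exact hA.op_notMem (he.symm ▸ hA.mem)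
  have hloop : ∀ e, (∃ g ∈ t, (coset H g) = e) →
      (cosetSkeleton H).IsLoop e := by
    rintro _ ⟨g, hg, rfl⟩
    exact Or.inr (Or.inr (op_eq_nx_nx ht hg))
  have hhs : ∀ e, ¬ (∃ g ∈ t, (coset H g) = e) →
      ¬ (∃ g ∈ t, (coset H g) = (cosetSkeleton H).op e) →
      ∃ A, (cosetSkeleton H).IsHalfSpace e A := by
    intro e h1 h2
    push Not at h1 h2
    exact exists_halfSpace_of_notMem ht e h1 h2
  refine ⟨⟨(coset H 1)⟩, noProperStable H, hop, nx_ne_of_op_ne ht hop,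
    ?_, ?_⟩
  · let M : Set (cosetSkeleton H).E := (fun g => (coset H g)) '' t
    have hM : M.Finite := hfin.image _
    -- Any edge outside the monogons of t has a half-space; this is a union of vertices, so the edge
    -- joins two different vertices and is not a loop.
    refine (hM.union (hM.image (cosetSkeleton H).op)).subset ?_
    intro e he
    by_contra hcon
    rw [Set.mem_union, not_or] at hcon
    obtain ⟨A, hA⟩ := hhs e hcon.1 (fun ⟨g, hg, h⟩ => hcon.2
      ⟨(cosetSkeleton H).op e, ⟨g, hg, h⟩, op_op _ _⟩)
    exact hA.op_notMem (mem_of_mem_vtx hA.nx_mem hA.mem he)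
  · intro e he
    exact hhs e (fun h => he (hloop _ h)) (fun h => he (isLoop_op_iff.1 (hloop _ h)))

theorem isLoopedTree_of_closure_eq (htop : H ≠ ⊤) (hfg : H.FG)
    (h : Subgroup.closure ((H : Set ModularGrp) ∩ conjugatesOf (X * Y)) = H) :
    ∃ t : Set ModularGrp, Subgroup.closure ((fun g => g⁻¹ * (Y * X) * g) '' t) = H ∧
      (cosetSkeleton H).IsLoopedTree := by
  obtain ⟨s, hs, hsfin, hsH⟩ := exists_finite_subset_closure_eq hfg h
  have hsub : s ⊆ Set.range (fun g : ModularGrp => g⁻¹ * (Y * X) * g) := by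
    intro x hx
    obtain ⟨c, hc⟩ := isConj_iff.1 (hs hx).2
    -- Since 𝕐² = 1, conjugating 𝕐𝕏 by 𝕐 gives 𝕏𝕐; hence the extra factor 𝕐.
    refine ⟨Y * c⁻¹, ?_⟩
    rw [← hc]
    simp only [mul_inv_rev, inv_inv, Y_inv, mul_assoc]
    rw [← mul_assoc Y Y, Y_mul_Y, one_mul]
  obtain ⟨t, -, htfin, rfl⟩ := hsfin.exists_subset_finite_image_eq
    (Set.image_univ ▸ hsub)
  exact ⟨t, hsH, isLoopedTree htop htfin hsH⟩

end cosetSkeleton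

/-! ## Finite hulls -/

namespace RibbonGraph31

variable {S : RibbonGraph31}

theorem mem_vtx_comm {x y : S.E} : x ∈ S.vtx y ↔ y ∈ S.vtx x := by
  rw [← vtx_eq_iff, ← vtx_eq_iff, eq_comm]

theorem mem_vtx_trans {x y z : S.E} (h : x ∈ S.vtx y) (h' : y ∈ S.vtx z) : x ∈ S.vtx z := by
  rwa [vtx_eq_of_mem h'] at h

/-- A set of vertices that induces a connected subgraph. -/
def ConnectedOn (S : RibbonGraph31) (W : Set S.E) : Prop :=
  ∀ K : Set S.E, (∀ e ∈ W, e ∈ K → S.nx e ∈ K) → (∀ e ∈ W, S.op e ∈ W → e ∈ K → S.op e ∈ K) →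
    ∀ e ∈ W, ∀ e' ∈ W, e ∈ K → e' ∈ K

theorem mem_of_mem_vtx_of_mem {W K : Set S.E} (hW : ∀ e ∈ W, S.nx e ∈ W)
    (hK : ∀ e ∈ W, e ∈ K → S.nx e ∈ K) {e x : S.E} (he : e ∈ W) (heK : e ∈ K)
    (hx : x ∈ S.vtx e) : x ∈ K :=
  (mem_of_mem_vtx (A := W ∩ K) (fun x hx => ⟨hW x hx.1, hK x hx.1 hx.2⟩) ⟨he, heK⟩ hx).2

/-- Each added vertex is adjacent to C, so membership in K passes between it and C along one edge.
-/
theorem ConnectedOn.attach {C U : Set S.E} (hC : S.ConnectedOn C) (hCU : C ⊆ U)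
    (hU : ∀ e ∈ U, S.nx e ∈ U) (h : ∀ u ∈ U, u ∈ C ∨ ∃ x ∈ C, S.op x ∈ S.vtx u) :
    S.ConnectedOn U := by
  intro K hnx hop
  have hCK := hC K (fun e he => hnx e (hCU he)) (fun e he he' => hop e (hCU he) (hCU he'))
  have hto : ∀ u ∈ U, u ∈ K → ∃ x ∈ C, x ∈ K := by
    intro u hu huK
    rcases h u hu with hu' | ⟨x, hx, hxu⟩
    · exact ⟨u, hu', huK⟩
    · refine ⟨x, hx, ?_⟩
      have h1 := mem_of_mem_vtx_of_mem hU hnx hu huK hxu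
      have h2 := hop (S.op x) (mem_of_mem_vtx hU hu hxu) (by rw [S.op_op]; exact hCU hx) h1
      rwa [S.op_op] at h2
  intro e he e' he' heK
  obtain ⟨x, hx, hxK⟩ := hto e he heK
  rcases h e' he' with hu' | ⟨y, hy, hyu⟩
  · exact hCK x hx e' hu' hxK
  · have hyU := mem_of_mem_vtx hU he' hyu
    exact mem_of_mem_vtx_of_mem hU hnx hyU (hop y (hCU hy) hyU (hCK x hx y hy hxK))
      (mem_vtx_comm.1 hyu)

theorem ConnectedOn.union {C C' : Set S.E} (hC : S.ConnectedOn C) (hC' : S.ConnectedOn C')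
    {x : S.E} (hx : x ∈ C) (hx' : x ∈ C') : S.ConnectedOn (C ∪ C') := by
  intro K hnx hop
  have h1 := hC K (fun e he => hnx e (Or.inl he)) (fun e he he' => hop e (Or.inl he) (Or.inl he'))
  have h2 := hC' K (fun e he => hnx e (Or.inr he)) (fun e he he' => hop e (Or.inr he) (Or.inr he'))
  have h3 : ∀ e ∈ C ∪ C', e ∈ K ↔ x ∈ K := by
    rintro e (he | he)
    · exact ⟨h1 e he x hx, h1 x hx e he⟩
    · exact ⟨h2 e he x hx', h2 x hx' e he⟩
  intro e he e' he' heK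
  exact (h3 e' he').2 ((h3 e he).1 heK)

theorem nx_mem_vtx {e x : S.E} (hx : x ∈ S.vtx e) : S.nx x ∈ S.vtx e := by
  rw [← vtx_eq_iff, vtx_nx, vtx_eq_iff]
  exact hx

theorem finite_vtx (e : S.E) : (S.vtx e).Finite := by
  unfold vtx
  exact Set.toFinite _

theorem connectedOn_vtx (e : S.E) : S.ConnectedOn (S.vtx e) := by
  intro K hnx _ x hx y hy hxK
  exact mem_of_mem_vtx_of_mem (fun _ => nx_mem_vtx) hnx hx hxK
    (mem_vtx_trans hy (mem_vtx_comm.1 hx))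

/-- The ends that can be joined to a base end by a finite connected set form a stable set, hence are
all ends. Finitely many such sets may be united, since they share the base end. -/
theorem exists_finite_connectedOn (hS : S.NoProperStable) [hne : Nonempty S.E] {F : Set S.E}
    (hF : F.Finite) : ∃ C : Set S.E, C.Finite ∧ (∀ e ∈ C, S.nx e ∈ C) ∧ S.ConnectedOn C ∧
      F ⊆ C ∧ C.Nonempty := by
  obtain ⟨e₀⟩ := hne
  have hpt : ∀ e, ∃ C : Set S.E, C.Finite ∧ (∀ e ∈ C, S.nx e ∈ C) ∧ S.ConnectedOn C ∧
      e ∈ C ∧ e₀ ∈ C := by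
    refine hS {e | ∃ C : Set S.E, C.Finite ∧ (∀ e ∈ C, S.nx e ∈ C) ∧ S.ConnectedOn C ∧
      e ∈ C ∧ e₀ ∈ C} ⟨e₀, ?_⟩ ?_ ?_
    · exact ⟨S.vtx e₀, finite_vtx e₀, fun _ => nx_mem_vtx, connectedOn_vtx e₀, S.mem_vtx_self e₀,
        S.mem_vtx_self e₀⟩
    · rintro e ⟨C, hfin, hnx, hC, he, he₀⟩
      have hnx' : ∀ x ∈ C ∪ S.vtx (S.op e), S.nx x ∈ C ∪ S.vtx (S.op e) := by
        rintro x (hx | hx)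
        · exact Or.inl (hnx x hx)
        · exact Or.inr (nx_mem_vtx hx)
      refine ⟨C ∪ S.vtx (S.op e), hfin.union (finite_vtx _), hnx',
        hC.attach Set.subset_union_left hnx' ?_, Or.inr (S.mem_vtx_self _), Or.inl he₀⟩
      rintro u (hu | hu)
      · exact Or.inl hu
      · exact Or.inr ⟨e, he, mem_vtx_comm.1 hu⟩
    · rintro e ⟨C, hfin, hnx, hC, he, he₀⟩
      exact ⟨C, hfin, hnx, hC, hnx e he, he₀⟩
  suffices h : ∃ C : Set S.E, C.Finite ∧ (∀ e ∈ C, S.nx e ∈ C) ∧ S.ConnectedOn C ∧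
      F ⊆ C ∧ e₀ ∈ C by
    obtain ⟨C, h1, h2, h3, h4, h5⟩ := h
    exact ⟨C, h1, h2, h3, h4, e₀, h5⟩
  induction F, hF using Set.Finite.induction_on with
  | empty =>
    obtain ⟨C, h1, h2, h3, -, h5⟩ := hpt e₀
    exact ⟨C, h1, h2, h3, Set.empty_subset _, h5⟩
  | @insert a F _ _ ih =>
    obtain ⟨C, h1, h2, h3, h4, h5⟩ := ih
    obtain ⟨C', h1', h2', h3', h4', h5'⟩ := hpt a
    refine ⟨C ∪ C', h1.union h1', ?_, h3.union h3' h5 h5', ?_, Or.inl h5⟩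
    · rintro x (hx | hx)
      · exact Or.inl (h2 x hx)
      · exact Or.inr (h2' x hx)
    · rintro x (rfl | hx)
      · exact Or.inr h4'
      · exact Or.inl (h4 hx)

/-- The ends of the edges other than loops of the subgraph induced by a set of vertices. -/
def inner (S : RibbonGraph31) (W : Set S.E) : Set S.E :=
  {e | e ∈ W ∧ S.op e ∈ W ∧ ¬ S.IsLoop e}

theorem op_mem_inner {W : Set S.E} {e : S.E} (he : e ∈ S.inner W) : S.op e ∈ S.inner W :=
  ⟨he.2.1, by rw [S.op_op]; exact he.1, fun h => he.2.2 (isLoop_op_iff.1 h)⟩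

/-- A finite set of vertices containing all loops that induces a subtree whose vertices have
valency three or one. -/
structure IsHull (S : RibbonGraph31) (W : Set S.E) : Prop where
  finite : W.Finite
  nonempty : W.Nonempty
  nx_mem : ∀ e ∈ W, S.nx e ∈ W
  connectedOn : S.ConnectedOn W
  loop_mem : ∀ e, S.IsLoop e → e ∈ W
  exists_inner : ∀ e ∈ W, ∃ x ∈ S.vtx e, x ∈ S.inner W
  trivalent : ∀ x ∈ S.inner W, ∀ y ∈ S.inner W, y ∈ S.vtx x → y ≠ x → ∀ z ∈ S.vtx x, z ∈ S.inner W

theorem eq_of_mem_vtx {a b c d : S.E} (hb : b ∈ S.vtx a) (hc : c ∈ S.vtx a) (hd : d ∈ S.vtx a)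
    (hab : a ≠ b) (hac : a ≠ c) (hbc : b ≠ c) : d = a ∨ d = b ∨ d = c := by
  rcases hb with rfl | rfl | rfl <;> rcases hc with rfl | rfl | rfl <;>
    rcases hd with rfl | rfl | rfl <;> simp_all

theorem exists_third (hnx : ∀ e, S.nx e ≠ e) {a b : S.E} (hb : b ∈ S.vtx a) :
    ∃ c ∈ S.vtx a, c ≠ a ∧ c ≠ b := by
  have h := S.nx_nx_nx
  rcases hb with rfl | rfl | rfl
  · exact ⟨S.nx b, Or.inr (Or.inl rfl), hnx _, hnx _⟩
  · refine ⟨S.nx (S.nx a), Or.inr (Or.inr rfl), fun h' => hnx a ?_, hnx _⟩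
    rw [← h', h, h']
  · exact ⟨S.nx a, Or.inr (Or.inl rfl), hnx _, (hnx _).symm⟩

/-- Take a finite connected C containing all loops and add all neighbouring vertices. A vertex of C
then keeps all its edges, and an added vertex is joined to the rest by a single edge, since edges
separate. -/
theorem IsLoopedTree.exists_isHull (hS : S.IsLoopedTree) : ∃ W, S.IsHull W := by
  have := hS.nonempty
  obtain ⟨C, hfin, hnx, hC, hloop, hne⟩ :=
    exists_finite_connectedOn hS.noProperStable hS.finite_loops
  let W : Set S.E := C ∪ {u | ∃ x ∈ C, S.op x ∈ S.vtx u}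
  have hCW : C ⊆ W := Set.subset_union_left
  have hWnx : ∀ e ∈ W, S.nx e ∈ W := by
    rintro e (he | ⟨x, hx, hxe⟩)
    · exact Or.inl (hnx e he)
    · exact Or.inr ⟨x, hx, by rwa [vtx_nx]⟩
  have hop : ∀ x ∈ C, S.op x ∈ W := fun x hx => Or.inr ⟨x, hx, S.mem_vtx_self _⟩
  refine ⟨W, ?_, hne.mono hCW, hWnx, hC.attach hCW hWnx fun u hu => hu, fun e he => hCW (hloop he),
    ?_, ?_⟩
  · refine hfin.union ((hfin.biUnion fun x _ => finite_vtx (S.op x)).subset ?_)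
    rintro u ⟨x, hx, hxu⟩
    exact Set.mem_biUnion hx (mem_vtx_comm.1 hxu)
  · intro e he
    by_cases heC : e ∈ C
    · by_cases hel : S.IsLoop e
      -- The loop occupies two of the three ends; the third cannot belong to a loop, as `op` would
      -- have to pair it with one of these two or with itself.
      · obtain ⟨f, hf, hfe, hfo⟩ := exists_third hS.nx_ne hel
        have hfC := mem_of_mem_vtx hnx heC hf
        refine ⟨f, hf, hCW hfC, hop f hfC, fun hfl => ?_⟩
        have h1 : S.op f ∈ S.vtx e := mem_vtx_trans hfl hf
        rcases eq_of_mem_vtx hel hf h1 (hS.op_ne e).symm hfe.symm hfo.symm with h | h | h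
        · exact hfo (by rw [← h, S.op_op])
        · exact hfe (S.op_injective h)
        · exact hS.op_ne f h
      · exact ⟨e, S.mem_vtx_self e, hCW heC, hop e heC, hel⟩
    · rcases he with he | ⟨x, hx, hxe⟩
      · exact absurd he heC
      · refine ⟨S.op x, hxe, hop x hx, by rw [S.op_op]; exact hCW hx, fun hl => heC ?_⟩
        rw [isLoop_op_iff] at hl
        exact mem_of_mem_vtx hnx hx (mem_vtx_trans (mem_vtx_comm.1 hxe) hl)
  · intro x hx y hy hyx hne z hz
    by_cases hxC : x ∈ C
    · have hzC := mem_of_mem_vtx hnx hxC hz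
      by_cases hzx : z = x
      · rwa [hzx]
      by_cases hzy : z = y
      · rwa [hzy]
      refine ⟨hCW hzC, hop z hzC, fun hl => ?_⟩
      rcases eq_of_mem_vtx hyx hz (mem_vtx_trans hl hz) hne.symm (Ne.symm hzx) (Ne.symm hzy)
        with h | h | h
      · exact hx.2.2 (h ▸ hl.op)
      · exact hy.2.2 (h ▸ hl.op)
      · exact hS.op_ne z h
    · exfalso
      -- Suppose an added vertex had two inner ends x and y. Without this vertex W is still
      -- connected, through C, yet the half-space of x contains `op y` and not `op x`.
      obtain ⟨A, hA⟩ := hS.exists_halfSpace x hx.2.2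
      have hCx : C ⊆ W \ S.vtx x := fun u hu => ⟨hCW hu, fun h =>
        hxC (mem_of_mem_vtx hnx hu (mem_vtx_comm.1 h))⟩
      have hU : ∀ e ∈ W \ S.vtx x, S.nx e ∈ W \ S.vtx x := fun e he => ⟨hWnx e he.1, fun h =>
        he.2 (by rw [← vtx_eq_iff, ← vtx_nx, vtx_eq_iff]; exact h)⟩
      have hconn : S.ConnectedOn (W \ S.vtx x) := hC.attach hCx hU fun u hu => hu.1
      refine hA.op_notMem (hconn A (fun e _ => hA.nx_mem e) ?_ (S.op y) ?_ (S.op x) ?_ ?_)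
      · intro e he he' heA
        refine (hA.op_mem_iff e ?_ ?_).2 heA
        · rintro rfl
          exact he.2 (S.mem_vtx_self _)
        · rintro rfl
          rw [S.op_op] at he'
          exact he'.2 (S.mem_vtx_self _)
      · exact ⟨hy.2.1, fun h => hy.2.2 (mem_vtx_trans h (mem_vtx_comm.1 hyx))⟩
      · exact ⟨hx.2.1, hx.2.2⟩
      · refine (hA.op_mem_iff y hne ?_).2 (mem_of_mem_vtx hA.nx_mem hA.mem hyx)
        rintro rfl
        exact hx.2.2 hyx

/-- The vertex of `x` is a leaf of the hull, without a loop. -/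
structure IsFreeLeaf (S : RibbonGraph31) (W : Set S.E) (x : S.E) : Prop where
  mem : x ∈ S.inner W
  eq_of_inner : ∀ z ∈ S.vtx x, z ∈ S.inner W → z = x
  not_isLoop : ∀ z ∈ S.vtx x, ¬ S.IsLoop z

theorem IsFreeLeaf.eq {W : Set S.E} (hW : ∀ e ∈ W, S.nx e ∈ W) {x z : S.E}
    (hx : S.IsFreeLeaf W x) (hz : z ∈ S.vtx x) (hzW : S.op z ∈ W) : z = x :=
  hx.eq_of_inner z hz ⟨mem_of_mem_vtx hW hx.mem.1 hz, hzW, hx.not_isLoop z hz⟩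

/-- Two free leaves adjacent to the same node can be cut off. -/
theorem IsHull.cut (hnx : ∀ e, S.nx e ≠ e) {W : Set S.E} (hW : S.IsHull W) {x y : S.E}
    (hx : S.IsFreeLeaf W x) (hy : S.IsFreeLeaf W y) (hxy : x ≠ y)
    (h : S.op y ∈ S.vtx (S.op x)) : S.IsHull (W \ (S.vtx x ∪ S.vtx y)) := by
  let W' := W \ (S.vtx x ∪ S.vtx y)
  have hopx : S.op x ∈ W' := by
    refine ⟨hx.mem.2.1, ?_⟩
    rintro (h' | h')
    · exact hx.mem.2.2 h'
    · exact hy.mem.2.2 (mem_vtx_trans h h')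
  have hopy : S.op y ∈ W' := by
    refine ⟨hy.mem.2.1, ?_⟩
    rintro (h' | h')
    · exact hx.mem.2.2 (mem_vtx_trans (mem_vtx_comm.1 h) h')
    · exact hy.mem.2.2 h'
  have hnx' : ∀ e ∈ W', S.nx e ∈ W' := by
    rintro e ⟨he, he'⟩
    refine ⟨hW.nx_mem e he, fun h' => he' ?_⟩
    simpa only [Set.mem_union, ← vtx_eq_iff, vtx_nx] using h'
  have hinner : ∀ z ∈ S.inner W, z ∈ W' → z ≠ S.op x → z ≠ S.op y → z ∈ S.inner W' := by
    intro z hz hz' hzx hzy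
    refine ⟨hz', ⟨hz.2.1, ?_⟩, hz.2.2⟩
    rintro (h' | h')
    · exact hzx (by rw [← hx.eq_of_inner _ h' (op_mem_inner hz), S.op_op])
    · exact hzy (by rw [← hy.eq_of_inner _ h' (op_mem_inner hz), S.op_op])
  have hinner' : ∀ z ∈ S.inner W', z ∈ S.inner W ∧ z ≠ S.op x ∧ z ≠ S.op y := by
    intro z hz
    refine ⟨⟨hz.1.1, hz.2.1.1, hz.2.2⟩, ?_, ?_⟩
    · rintro rfl
      have := hz.2.1.2
      rw [S.op_op] at this
      exact this (Or.inl (S.mem_vtx_self _))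
    · rintro rfl
      have := hz.2.1.2
      rw [S.op_op] at this
      exact this (Or.inr (S.mem_vtx_self _))
  refine ⟨hW.finite.subset Set.sdiff_subset, ⟨S.op x, hopx⟩, hnx', ?_, ?_, ?_, ?_⟩
  · intro K hKnx hKop e he e' he' heK
    -- K is extended to the two removed leaves by giving them the status of their common node;
    -- connectedness of W then applies.
    let K' : Set S.E := {u | (u ∈ W' ∧ u ∈ K) ∨ (u ∈ S.vtx x ∪ S.vtx y ∧ S.op x ∈ K)}
    have hK' : e' ∈ K' := by
      refine hW.connectedOn K' ?_ ?_ e he.1 e' he'.1 (Or.inl ⟨he, heK⟩)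
      · rintro u hu (⟨h1, h2⟩ | ⟨h1, h2⟩)
        · exact Or.inl ⟨hnx' u h1, hKnx u h1 h2⟩
        · exact Or.inr ⟨h1.imp nx_mem_vtx nx_mem_vtx, h2⟩
      · intro u hu hu' huK
        have hxK : S.op y ∈ K → S.op x ∈ K := fun h' =>
          mem_of_mem_vtx_of_mem hnx' hKnx hopy h' (mem_vtx_comm.1 h)
        have hyK : S.op x ∈ K → S.op y ∈ K := fun h' =>
          mem_of_mem_vtx_of_mem hnx' hKnx hopx h' h
        rcases huK with ⟨h1, h2⟩ | ⟨h1 | h1, h2⟩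
        · by_cases h3 : S.op u ∈ S.vtx x ∪ S.vtx y
          · refine Or.inr ⟨h3, ?_⟩
            rcases h3 with h3 | h3
            · rwa [← hx.eq hW.nx_mem h3 (by rwa [S.op_op]), S.op_op]
            · apply hxK
              rwa [← hy.eq hW.nx_mem h3 (by rwa [S.op_op]), S.op_op]
          · exact Or.inl ⟨⟨hu', h3⟩, hKop u h1 ⟨hu', h3⟩ h2⟩
        · rw [hx.eq hW.nx_mem h1 hu']
          exact Or.inl ⟨hopx, h2⟩
        · rw [hy.eq hW.nx_mem h1 hu']
          exact Or.inl ⟨hopy, hyK h2⟩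
    rcases hK' with h1 | h1
    · exact h1.2
    · exact absurd h1.1 he'.2
  · intro e he
    refine ⟨hW.loop_mem e he, ?_⟩
    rintro (h' | h')
    · exact hx.not_isLoop e h' he
    · exact hy.not_isLoop e h' he
  · intro u hu
    by_cases hux : S.op x ∈ S.vtx u
    -- The node that carried the two leaves becomes a leaf, with its third end as the only inner
    -- one.
    · obtain ⟨z, hz, hzx, hzy⟩ := exists_third hnx h
      have hzu := mem_vtx_trans hz hux
      refine ⟨z, hzu, hinner z ?_ (mem_of_mem_vtx hnx' hu hzu) hzx hzy⟩
      exact hW.trivalent _ (op_mem_inner hx.mem) _ (op_mem_inner hy.mem) h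
        (fun h' => hxy (S.op_injective h').symm) z hz
    · obtain ⟨z, hz, hzi⟩ := hW.exists_inner u hu.1
      refine ⟨z, hz, hinner z hzi (mem_of_mem_vtx hnx' hu hz) ?_ ?_⟩
      · rintro rfl
        exact hux hz
      · rintro rfl
        exact hux (mem_vtx_trans (mem_vtx_comm.1 h) hz)
  · intro a ha b hb hba hne c hc
    obtain ⟨ha', hax, hay⟩ := hinner' a ha
    obtain ⟨hb', hbx, hby⟩ := hinner' b hb
    by_cases hca : c = a
    · rwa [hca]
    by_cases hcb : c = b
    · rwa [hcb]
    refine hinner c (hW.trivalent a ha' b hb' hba hne c hc) (mem_of_mem_vtx hnx' ha.1 hc) ?_ ?_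
    · rintro rfl
      rcases eq_of_mem_vtx hba hc (mem_vtx_trans h hc) hne.symm (Ne.symm hca) (Ne.symm hcb)
        with h' | h' | h'
      · exact hay h'.symm
      · exact hby h'.symm
      · exact hxy (S.op_injective h').symm
    · rintro rfl
      rcases eq_of_mem_vtx hba hc (mem_vtx_trans (mem_vtx_comm.1 h) hc) hne.symm (Ne.symm hca)
        (Ne.symm hcb) with h' | h' | h'
      · exact hax h'.symm
      · exact hbx h'.symm
      · exact hxy (S.op_injective h')

/-- There is a hull in which no two free leaves are adjacent to the same node. -/
theorem IsLoopedTree.exists_reduced_isHull (hS : S.IsLoopedTree) : ∃ W, S.IsHull W ∧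
    ∀ x y, S.IsFreeLeaf W x → S.IsFreeLeaf W y → S.op y ∈ S.vtx (S.op x) → x = y := by
  -- In a hull with the fewest ends no pair of sibling free leaves is left to cut.
  obtain ⟨W, hW, hmin⟩ := WellFounded.has_min (measure (Set.ncard (α := S.E))).wf {W | S.IsHull W}
    hS.exists_isHull
  refine ⟨W, hW, fun x y hx hy h => ?_⟩
  by_contra hxy
  refine hmin _ (IsHull.cut hS.nx_ne hW hx hy hxy h) ?_
  refine Set.ncard_lt_ncard ?_ hW.finite
  refine ⟨Set.sdiff_subset, fun h' => (h' hx.mem.1).2 (Or.inl (S.mem_vtx_self x))⟩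

end RibbonGraph31

/-! ## The tree of a hull -/

namespace RibbonGraph31

variable {S : RibbonGraph31} {W : Set S.E}

/-- The vertices of a hull. -/
abbrev HullVertex (S : RibbonGraph31) (W : Set S.E) : Type :=
  {v : Set S.E // ∃ e ∈ W, v = S.vtx e}

/-- The graph induced by a set of vertices, with the loops removed. -/
def hullGraph (S : RibbonGraph31) (W : Set S.E) : SimpleGraph (HullVertex S W) where
  Adj v u := ∃ e ∈ S.inner W, v.1 = S.vtx e ∧ u.1 = S.vtx (S.op e)
  symm := ⟨fun v u ⟨e, he, hv, hu⟩ => ⟨S.op e, op_mem_inner he, hu, by rwa [S.op_op]⟩⟩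
  loopless := ⟨fun v ⟨e, he, hv, hu⟩ => he.2.2 (vtx_eq_iff.1 (hu.symm.trans hv))⟩

/-- The vertex of an end in a hull. -/
def hullVertex (e : S.inner W) : HullVertex S W := ⟨S.vtx e, e, e.2.1, rfl⟩

/-- The other end of the same edge. -/
def innerOp (e : S.inner W) : S.inner W := ⟨S.op e, op_mem_inner e.2⟩

theorem innerOp_innerOp (e : S.inner W) : innerOp (innerOp e) = e := Subtype.ext (S.op_op e)

theorem hullVertex_eq_iff {e x : S.inner W} : hullVertex x = hullVertex e ↔ x.1 ∈ S.vtx e := by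
  rw [← vtx_eq_iff]
  exact Subtype.ext_iff

theorem hullGraph_adj (e : S.inner W) :
    (hullGraph S W).Adj (hullVertex e) (hullVertex (innerOp e)) := ⟨e, e.2, rfl, rfl⟩

/-- The dart of an end. -/
def hullDart (e : S.inner W) : (hullGraph S W).Dart :=
  ⟨(hullVertex e, hullVertex (innerOp e)), hullGraph_adj e⟩

theorem hullDart_symm (e : S.inner W) : (hullDart e).symm = hullDart (innerOp e) := by
  ext1
  change (hullVertex (innerOp e), hullVertex e) =
    (hullVertex (innerOp e), hullVertex (innerOp (innerOp e)))
  rw [innerOp_innerOp]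

/-- There are no multiple edges: the half-space of y is left only by the edge of y, while a parallel
edge x would leave it too. Thus ends can be identified with darts of a simple graph. -/
theorem IsLoopedTree.eq_of_hullVertex_eq (hS : S.IsLoopedTree) {x y : S.inner W}
    (h : hullVertex x = hullVertex y) (h' : hullVertex (innerOp x) = hullVertex (innerOp y)) :
    x = y := by
  rw [hullVertex_eq_iff] at h h'
  obtain ⟨A, hA⟩ := hS.exists_halfSpace y.1 y.2.2.2
  by_contra hne
  have hxA : x.1 ∈ A := mem_of_mem_vtx hA.nx_mem hA.mem h
  refine hA.op_notMem (mem_of_mem_vtx hA.nx_mem ((hA.op_mem_iff x.1 ?_ ?_).2 hxA)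
    (mem_vtx_comm.1 h'))
  · exact fun h => hne (Subtype.ext h)
  · intro h''
    exact y.2.2.2 (show S.op y.1 ∈ S.vtx y.1 from h'' ▸ h)

theorem IsLoopedTree.hullDart_bijective (hS : S.IsLoopedTree) :
    Function.Bijective (hullDart (S := S) (W := W)) := by
  constructor
  · intro x y h
    exact hS.eq_of_hullVertex_eq (congrArg (fun d => d.fst) h) (congrArg (fun d => d.snd) h)
  · rintro ⟨⟨v, u⟩, ⟨e, he, hv, hu⟩⟩
    refine ⟨⟨e, he⟩, ?_⟩
    ext1
    exact Prod.ext (Subtype.ext hv.symm) (Subtype.ext hu.symm)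

/-- The ends of a hull correspond to the darts of its graph. -/
noncomputable def IsLoopedTree.dartEquiv (hS : S.IsLoopedTree) :
    S.inner W ≃ (hullGraph S W).Dart :=
  Equiv.ofBijective _ hS.hullDart_bijective

open Classical in
/-- The next end of the hull at the same vertex. -/
noncomputable def innerRot (hnx : ∀ e, S.nx e ≠ e) (hW : S.IsHull W) :
    Equiv.Perm (S.inner W) where
  toFun e := if h : S.nx e ∈ S.inner W then ⟨S.nx e, h⟩ else e
  invFun e := if h : S.nx (S.nx e) ∈ S.inner W then ⟨S.nx (S.nx e), h⟩ else e
  left_inv e := by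
    by_cases h : S.nx e ∈ S.inner W
    · simp [h, S.nx_nx_nx]
    · have h' : S.nx (S.nx e) ∉ S.inner W := fun h' => h
        (hW.trivalent e e.2 _ h' (Or.inr (Or.inr rfl))
          (fun h => hnx e (by rw [← h, S.nx_nx_nx, h])) _ (Or.inr (Or.inl rfl)))
      simp [h, h']
  right_inv e := by
    by_cases h : S.nx (S.nx e) ∈ S.inner W
    · simp [h, S.nx_nx_nx]
    · have h' : S.nx e ∉ S.inner W := fun h' => h
        (hW.trivalent e e.2 _ h' (Or.inr (Or.inl rfl)) (hnx e) _ (Or.inr (Or.inr rfl)))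
      simp [h, h']

theorem innerRot_mem_vtx (hnx : ∀ e, S.nx e ≠ e) (hW : S.IsHull W) (e : S.inner W) :
    (innerRot hnx hW e).1 ∈ S.vtx e := by
  by_cases h : S.nx e ∈ S.inner W
  · simp [innerRot, h, mem_vtx_iff]
  · simp [innerRot, h, mem_vtx_iff]

theorem innerRot_of_mem (hnx : ∀ e, S.nx e ≠ e) (hW : S.IsHull W) (e : S.inner W)
    (h : S.nx e ∈ S.inner W) : innerRot hnx hW e = ⟨S.nx e, h⟩ := by
  simp [innerRot, h]

/-- The rotation of the darts of a hull. -/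
noncomputable def IsLoopedTree.rot (hS : S.IsLoopedTree) (hW : S.IsHull W) :
    Equiv.Perm (hullGraph S W).Dart :=
  hS.dartEquiv.permCongr (innerRot hS.nx_ne hW)

theorem IsLoopedTree.rot_hullDart (hS : S.IsLoopedTree) (hW : S.IsHull W) (e : S.inner W) :
    hS.rot hW (hullDart e) = hullDart (innerRot hS.nx_ne hW e) := by
  have h : hS.dartEquiv.symm (hullDart e) = e := hS.dartEquiv.symm_apply_apply e
  rw [rot, Equiv.permCongr_apply, h]
  rfl

theorem IsLoopedTree.rot_isCycleOn (hS : S.IsLoopedTree) (hW : S.IsHull W) (v : HullVertex S W) :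
    (hS.rot hW).IsCycleOn {d | d.fst = v} := by
  constructor
  · refine Equiv.bijOn _ fun d => ?_
    obtain ⟨e, rfl⟩ := hS.hullDart_bijective.2 d
    have h : hullVertex (innerRot hS.nx_ne hW e) = hullVertex e :=
      hullVertex_eq_iff.2 (innerRot_mem_vtx _ _ _)
    rw [hS.rot_hullDart hW]
    change hullVertex _ = v ↔ hullVertex _ = v
    rw [h]
  · intro d hd d' hd'
    obtain ⟨e, rfl⟩ := hS.hullDart_bijective.2 d
    obtain ⟨e', rfl⟩ := hS.hullDart_bijective.2 d'
    have h : hullVertex e' = hullVertex e := hd'.trans hd.symm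
    rw [hullVertex_eq_iff] at h
    rcases h with h | h | h
    · rw [Subtype.ext h]
    · refine ⟨1, ?_⟩
      rw [zpow_one, hS.rot_hullDart hW, innerRot_of_mem _ _ _ (h ▸ e'.2)]
      exact congrArg _ (Subtype.ext h.symm)
    · have h' : S.nx e' = e := by rw [h, S.nx_nx_nx]
      refine Equiv.Perm.SameCycle.symm ⟨1, ?_⟩
      rw [zpow_one, hS.rot_hullDart hW, innerRot_of_mem _ _ _ (h' ▸ e.2)]
      exact congrArg _ (Subtype.ext h')

theorem ncard_vtx (hnx : ∀ e, S.nx e ≠ e) (e : S.E) : (S.vtx e).ncard = 3 := by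
  refine Set.ncard_eq_three.2 ⟨_, _, _, (hnx e).symm, fun h => hnx e ?_, (hnx _).symm, rfl⟩
  conv_lhs => rw [h]
  rw [S.nx_nx_nx]

theorem IsLoopedTree.ncard_neighborSet (hS : S.IsLoopedTree) (e : S.inner W) :
    ((hullGraph S W).neighborSet (hullVertex e)).ncard = (S.vtx e ∩ S.inner W).ncard := by
  have h1 : (hullGraph S W).neighborSet (hullVertex e) =
      (fun z : S.inner W => hullVertex (innerOp z)) '' {z | z.1 ∈ S.vtx e} := by
    ext u
    constructor
    · rintro ⟨z, hz, hv, hu⟩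
      exact ⟨⟨z, hz⟩, vtx_eq_iff.1 hv.symm, Subtype.ext hu.symm⟩
    · rintro ⟨z, hz, rfl⟩
      exact ⟨z.1, z.2, (vtx_eq_of_mem hz).symm, rfl⟩
  have h2 : S.vtx e ∩ S.inner W = Subtype.val '' {z : S.inner W | z.1 ∈ S.vtx e} := by
    ext z
    constructor
    · rintro ⟨h, h'⟩
      exact ⟨⟨z, h'⟩, h, rfl⟩
    · rintro ⟨z, h, rfl⟩
      exact ⟨h, z.2⟩
  rw [h1, h2, Set.ncard_image_of_injective _ Subtype.val_injective]
  refine Set.InjOn.ncard_image ?_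
  intro x hx y hy hxy
  refine hS.eq_of_hullVertex_eq (hullVertex_eq_iff.2 ?_) hxy
  exact mem_vtx_trans hx (mem_vtx_comm.1 hy)

theorem IsLoopedTree.ncard_neighborSet_node (hS : S.IsLoopedTree) (hW : S.IsHull W)
    (e : S.inner W) (h : S.nx e ∈ S.inner W) :
    ((hullGraph S W).neighborSet (hullVertex e)).ncard = 3 := by
  rw [hS.ncard_neighborSet, Set.inter_eq_left.2, ncard_vtx hS.nx_ne]
  exact hW.trivalent e e.2 _ h (Or.inr (Or.inl rfl)) (hS.nx_ne e)

theorem IsHull.eq_of_nx_notMem (hW : S.IsHull W) {e : S.E} (he : e ∈ S.inner W)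
    (h : S.nx e ∉ S.inner W) {z : S.E} (hz : z ∈ S.vtx e) (hzW : z ∈ S.inner W) : z = e := by
  by_contra hne
  exact h (hW.trivalent e he z hzW hz hne _ (Or.inr (Or.inl rfl)))

theorem IsLoopedTree.ncard_neighborSet_leaf (hS : S.IsLoopedTree) (hW : S.IsHull W)
    (e : S.inner W) (h : S.nx e ∉ S.inner W) :
    ((hullGraph S W).neighborSet (hullVertex e)).ncard = 1 := by
  rw [hS.ncard_neighborSet]
  refine Set.ncard_eq_one.2 ⟨e, ?_⟩
  ext z
  constructor
  · rintro ⟨hz, hzW⟩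
    exact hW.eq_of_nx_notMem e.2 h hz hzW
  · rintro rfl
    exact ⟨S.mem_vtx_self _, e.2⟩

theorem IsHull.exists_hullVertex_eq (hW : S.IsHull W) (v : HullVertex S W) :
    ∃ e : S.inner W, hullVertex e = v := by
  obtain ⟨v, e, he, rfl⟩ := v
  obtain ⟨x, hx, hxW⟩ := hW.exists_inner e he
  exact ⟨⟨x, hxW⟩, Subtype.ext (vtx_eq_of_mem hx)⟩

theorem IsHull.connected (hW : S.IsHull W) : (hullGraph S W).Connected := by
  have : Nonempty (HullVertex S W) := by
    obtain ⟨e, he⟩ := hW.nonempty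
    exact ⟨⟨_, e, he, rfl⟩⟩
  refine ⟨fun u v => ?_⟩
  obtain ⟨u, a, ha, rfl⟩ := u
  obtain ⟨v, b, hb, rfl⟩ := v
  let K : Set S.E := {x | ∃ h : x ∈ W, (hullGraph S W).Reachable ⟨_, a, ha, rfl⟩ ⟨_, x, h, rfl⟩}
  have hK : b ∈ K := by
    refine hW.connectedOn K ?_ ?_ a ha b hb ⟨ha, SimpleGraph.Reachable.refl _⟩
    · rintro e he ⟨h, h'⟩
      refine ⟨hW.nx_mem e he, ?_⟩
      convert h' using 2
      exact S.vtx_nx e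
    · rintro e he heW ⟨h, h'⟩
      refine ⟨heW, ?_⟩
      by_cases hl : S.IsLoop e
      · convert h' using 2
        exact vtx_eq_of_mem hl
      · exact h'.trans (hullGraph_adj ⟨e, he, heW, hl⟩).reachable
  exact hK.2

theorem IsLoopedTree.isTree (hS : S.IsLoopedTree) (hW : S.IsHull W) :
    (hullGraph S W).IsTree := by
  refine ⟨hW.connected, SimpleGraph.isAcyclic_iff_forall_adj_isBridge.2 ?_⟩
  rintro v u ⟨e, he, hv, hu⟩
  obtain ⟨A, hA⟩ := hS.exists_halfSpace e he.2.2
  rw [SimpleGraph.isBridge_iff]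
  rintro ⟨p⟩
  have key : ∀ {a b : HullVertex S W}
      (p : ((hullGraph S W) \ SimpleGraph.fromEdgeSet {s(v, u)}).Walk a b),
      a.1 ⊆ A → b.1 ⊆ A := by
    intro a b p
    induction p with
    | nil => exact id
    | @cons a b c hab p ih =>
      intro ha
      refine ih ?_
      obtain ⟨⟨x, hx, hax, hbx⟩, hne⟩ := hab
      rw [SimpleGraph.fromEdgeSet_adj] at hne
      have hx1 : x ∈ A := ha (hax ▸ S.mem_vtx_self x)
      have hx2 : S.op x ∈ A := by
        refine (hA.op_mem_iff x ?_ ?_).2 hx1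
        · rintro rfl
          refine hne ⟨?_, ?_⟩
          · rw [Subtype.ext (hax.trans hv.symm), Subtype.ext (hbx.trans hu.symm)]
            rfl
          · intro h
            exact hx.2.2 (vtx_eq_iff.1 ((hbx.symm.trans (congrArg Subtype.val h).symm).trans hax))
        · rintro rfl
          exact hA.op_notMem hx1
      intro z hz
      rw [hbx] at hz
      exact mem_of_mem_vtx hA.nx_mem hx2 hz
  have hvA : v.1 ⊆ A := by
    rw [hv]
    exact fun z hz => mem_of_mem_vtx hA.nx_mem hA.mem hz
  exact hA.op_notMem (key p hvA (hu ▸ S.mem_vtx_self _))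

/-- The admissible tree of a hull. -/
noncomputable def IsLoopedTree.tree (hS : S.IsLoopedTree) (hW : S.IsHull W) : AdmissibleTree where
  V := HullVertex S W
  finite := by
    have : Finite W := hW.finite
    refine Finite.of_surjective (fun e : W => (⟨S.vtx e, e, e.2, rfl⟩ : HullVertex S W)) ?_
    rintro ⟨v, e, he, rfl⟩
    exact ⟨⟨e, he⟩, rfl⟩
  graph := hullGraph S W
  isTree := hS.isTree hW
  valency v := by
    obtain ⟨e, rfl⟩ := hW.exists_hullVertex_eq v
    by_cases h : S.nx e ∈ S.inner W
    · exact Or.inl (hS.ncard_neighborSet_node hW e h)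
    · exact Or.inr (hS.ncard_neighborSet_leaf hW e h)
  rot := hS.rot hW
  rot_cycle := hS.rot_isCycleOn hW

theorem IsLoopedTree.isLeaf_iff (hS : S.IsLoopedTree) (hW : S.IsHull W) (e : S.inner W) :
    (hS.tree hW).IsLeaf (hullVertex e) ↔ S.nx e ∉ S.inner W := by
  constructor
  · intro h h'
    have h1 : _ = 1 := h
    have h2 := hS.ncard_neighborSet_node hW e h'
    change ((hullGraph S W).neighborSet (hullVertex e)).ncard = 1 at h1
    omega
  · exact hS.ncard_neighborSet_leaf hW e

open Classical in
/-- The admissible pair of a hull. -/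
noncomputable def IsLoopedTree.pair (hS : S.IsLoopedTree) (hW : S.IsHull W)
    (hred : ∀ x y, S.IsFreeLeaf W x → S.IsFreeLeaf W y → S.op y ∈ S.vtx (S.op x) → x = y) :
    AdmissiblePair where
  tree := hS.tree hW
  ell v := if ∃ e ∈ (v.1 : HullVertex S W).1, S.IsLoop e then LeafType.zero else LeafType.triangle
  admissible := by
    rintro ⟨v₁, h₁⟩ ⟨v₂, h₂⟩ hne ht₁ ht₂ ⟨u, hu₁, hu₂⟩
    have aux : ∀ v : HullVertex S W, (hS.tree hW).IsLeaf v →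
        ¬ (∃ e ∈ v.1, S.IsLoop e) → (hullGraph S W).Adj u v →
        ∃ x, S.IsFreeLeaf W x ∧ v.1 = S.vtx x ∧ u.1 = S.vtx (S.op x) := by
      intro v hv hl huv
      obtain ⟨x, hx, hvx, hux⟩ := huv.symm
      have hvx' : v = hullVertex ⟨x, hx⟩ := Subtype.ext hvx
      rw [hvx', hS.isLeaf_iff] at hv
      refine ⟨x, ⟨hx, fun z hz hzW => hW.eq_of_nx_notMem hx hv hz hzW, fun z hz hzl => hl
        ⟨z, hvx ▸ hz, hzl⟩⟩, hvx, hux⟩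
    have ht₁' : ¬ ∃ e ∈ (v₁ : HullVertex S W).1, S.IsLoop e := by
      intro h
      simp only [if_pos h] at ht₁
      cases ht₁
    have ht₂' : ¬ ∃ e ∈ (v₂ : HullVertex S W).1, S.IsLoop e := by
      intro h
      simp only [if_pos h] at ht₂
      cases ht₂
    obtain ⟨x, hx, hvx, hux⟩ := aux v₁ h₁ ht₁' hu₁
    obtain ⟨y, hy, hvy, huy⟩ := aux v₂ h₂ ht₂' hu₂
    have hxy := hred x y hx hy (vtx_eq_iff.1 (huy.symm.trans hux))
    refine hne (Subtype.ext (Subtype.ext ?_))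
    change (v₁ : HullVertex S W).1 = (v₂ : HullVertex S W).1
    rw [hvx, hvy, hxy]

end RibbonGraph31

/-! ## Morphisms from the skeleton of an admissible pair -/

namespace RibbonGraph31

/-- The ends at the vertices of a branch pointing away from the root. -/
def branch (R : RibbonGraph31) (e : R.E) : List Bool → Bool → R.E
  | [], false => R.nx e
  | [], true => R.nx (R.nx e)
  | c :: w, false => R.nx (R.op (branch R e w c))
  | c :: w, true => R.nx (R.nx (R.op (branch R e w c)))

theorem branch_true (R : RibbonGraph31) (e : R.E) (w : List Bool) :
    R.branch e w true = R.nx (R.branch e w false) := by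
  cases w <;> rfl

end RibbonGraph31

namespace AdmissiblePair

open RibbonGraph31

/-- The extension of a map defined on the darts of the tree to the skeleton. -/
def extend (P : AdmissiblePair) (R : RibbonGraph31) (g : P.tree.graph.Dart → R.E) :
    P.skeleton.E → R.E
  | .edge d _ => g d
  | .loop d _ false => R.nx (g d)
  | .loop d _ true => R.nx (R.nx (g d))
  | .down d _ w b => R.branch (g d) w b
  | .up d _ w b => R.op (R.branch (g d) w b)

/-- The admissible function takes values in `{0, △}`. -/
def IsPlain (P : AdmissiblePair) : Prop :=
  ∀ v, P.ell v = LeafType.zero ∨ P.ell v = LeafType.triangle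

variable {P : AdmissiblePair} {R : RibbonGraph31} {g : P.tree.graph.Dart → R.E}

theorem IsPlain.typ_cases (hP : P.IsPlain) (d : P.tree.graph.Dart) :
    P.typ d = none ∨ P.typ d = some .zero ∨ P.typ d = some .triangle := by
  unfold typ
  split_ifs with h
  · rcases hP ⟨d.fst, h⟩ with h' | h' <;> simp [h']
  · exact Or.inl rfl

theorem IsPlain.typ_ne_white (hP : P.IsPlain) (d : P.tree.graph.Dart) :
    P.typ d ≠ some .white := by
  rcases hP.typ_cases d with h | h | h <;> simp [h]

theorem IsPlain.op_edge (hP : P.IsPlain) (d : P.tree.graph.Dart) (h) :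
    P.skeleton.op (.edge d h) = .edge d.symm (hP.typ_ne_white _) := by
  exact dif_neg (hP.typ_ne_white _)

theorem IsPlain.extend_nx (hP : P.IsPlain)
    (hrot : ∀ d, P.typ d = none → g (P.tree.rot d) = R.nx (g d)) (x : P.skeleton.E) :
    P.extend R g (P.skeleton.nx x) = R.nx (P.extend R g x) := by
  have h3 := R.nx_nx_nx
  rcases x with ⟨d, h⟩ | ⟨d, h, b⟩ | ⟨d, h, w, b⟩ | ⟨d, h, w, b⟩
  · rcases hP.typ_cases d with h' | h' | h'
    · exact (congrArg _ (P.nx_node d h h')).trans (hrot d h')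
    · exact congrArg (P.extend R g) (P.nx_zero d h h')
    · exact congrArg (P.extend R g) (P.nx_triangle d h h')
  · cases b
    · rfl
    · exact (h3 _).symm
  · cases b
    · exact R.branch_true _ _
    · cases w
      · exact (h3 _).symm
      · exact (h3 _).symm
  · rfl

theorem IsPlain.extend_op (hP : P.IsPlain) (hsymm : ∀ d, g d.symm = R.op (g d))
    (x : P.skeleton.E) (hx : ∀ d h b, x ≠ .loop d h b) :
    P.extend R g (P.skeleton.op x) = R.op (P.extend R g x) := by
  rcases x with ⟨d, h⟩ | ⟨d, h, b⟩ | ⟨d, h, w, b⟩ | ⟨d, h, w, b⟩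
  · exact (congrArg _ (hP.op_edge d h)).trans (hsymm d)
  · exact absurd rfl (hx d h b)
  · rfl
  · exact (R.op_op _).symm

/-- From any end of the skeleton, one comes to an end of the tree. -/
theorem exists_edge_mem (P : AdmissiblePair) {A : Set P.skeleton.E} (hne : A.Nonempty)
    (hop : ∀ x ∈ A, P.skeleton.op x ∈ A) (hnx : ∀ x ∈ A, P.skeleton.nx x ∈ A) :
    ∃ d h, End.edge d h ∈ A := by
  have key : ∀ d h w b, End.down d h w b ∈ A → ∃ d h, End.edge d h ∈ A := by
    intro d h w
    induction w with
    | nil =>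
      rintro (_ | _) hA
      · exact ⟨_, _, hnx _ (hnx _ hA)⟩
      · exact ⟨_, _, hnx _ hA⟩
    | cons c w ih =>
      rintro (_ | _) hA
      · exact ih c (hop _ (hnx _ (hnx _ hA)))
      · exact ih c (hop _ (hnx _ hA))
  obtain ⟨x, hx⟩ := hne
  rcases x with ⟨d, h⟩ | ⟨d, h, b⟩ | ⟨d, h, w, b⟩ | ⟨d, h, w, b⟩
  · exact ⟨d, h, hx⟩
  · cases b
    · exact ⟨_, _, hnx _ (hnx _ hx)⟩
    · exact ⟨_, _, hnx _ hx⟩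
  · exact key d h w b hx
  · exact key d h w b (hop _ hx)

/-- If all ends of the tree belong to a stable set, then all ends do. -/
theorem IsPlain.mem_of_edge_mem {A : Set P.skeleton.E}
    (hop : ∀ x ∈ A, P.skeleton.op x ∈ A) (hnx : ∀ x ∈ A, P.skeleton.nx x ∈ A)
    (h : ∀ d h, End.edge d h ∈ A) (x : P.skeleton.E) : x ∈ A := by
  have key : ∀ d h w b, End.down d h w b ∈ A := by
    intro d h' w
    induction w with
    | nil =>
      have h1 : End.down d h' [] false ∈ A := by
        have := hnx _ (h d (by simp [h']))
        rwa [show P.skeleton.nx (.edge d _) = _ from P.nx_triangle d _ h'] at this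
      rintro (_ | _)
      · exact h1
      · exact hnx _ h1
    | cons c w ih =>
      have h1 : End.down d h' (c :: w) false ∈ A := hnx _ (hop _ (ih c))
      rintro (_ | _)
      · exact h1
      · exact hnx _ h1
  rcases x with ⟨d, h'⟩ | ⟨d, h', b⟩ | ⟨d, h', w, b⟩ | ⟨d, h', w, b⟩
  · exact h d h'
  · have h1 : End.loop d h' false ∈ A := by
      have := hnx _ (h d (by simp [h']))
      rwa [show P.skeleton.nx (.edge d _) = _ from P.nx_zero d _ h'] at this
    cases b
    · exact h1
    · exact hnx _ h1
  · exact key d h' w b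
  · exact hop _ (key d h' w b)

end AdmissiblePair

namespace RibbonGraph31

open AdmissiblePair

variable {S : RibbonGraph31} {W : Set S.E}

theorem ConnectedOn.subset_halfSpace (hW : S.ConnectedOn W) {x : S.E} (hx : x ∈ W)
    (hxW : S.op x ∉ W) {A : Set S.E} (hA : S.IsHalfSpace x A) : W ⊆ A := by
  intro y hy
  refine hW A (fun e _ => hA.nx_mem e) (fun e he he' heA => ?_) x hx y hy hA.mem
  refine (hA.op_mem_iff e ?_ ?_).2 heA
  · rintro rfl
    exact hxW he'
  · rintro rfl
    exact hxW he

/-- The half-spaces along a path without backtracking are nested. -/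
theorem IsHalfSpace.subset (hS : S.NoProperStable) {x x' : S.E} {A A' : Set S.E}
    (hA : S.IsHalfSpace x A) (hA' : S.IsHalfSpace x' A') (hx' : x' ∈ S.vtx (S.op x))
    (hne : x' ≠ S.op x) : A ⊆ A' := by
  by_contra hcon
  obtain ⟨z, hz, hz'⟩ := Set.not_subset.1 hcon
  have hx'A : x' ∉ A := fun h => hA.op_notMem (mem_of_mem_vtx hA.nx_mem h (mem_vtx_comm.1 hx'))
  have hopx : S.op x ∈ A' := mem_of_mem_vtx hA'.nx_mem hA'.mem (mem_vtx_comm.1 hx')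
  have hxA' : x ∈ A' := by
    refine (hA'.op_mem_iff x ?_ ?_).1 hopx
    · rintro rfl
      exact hx'A hA.mem
    · rintro rfl
      rw [S.op_op] at hne
      exact hne rfl
  have hopx'A : S.op x' ∉ A := fun h => hx'A ((hA.op_mem_iff x' (fun h => hx'A (h ▸ hA.mem)) hne).1 h)
  have h := hS (A \ A') ⟨z, hz, hz'⟩ ?_ ?_ (S.op x)
  · exact hA.op_notMem h.1
  · rintro y ⟨hy, hy'⟩
    refine ⟨(hA.op_mem_iff y ?_ ?_).2 hy, fun h => hy' ((hA'.op_mem_iff y ?_ ?_).1 h)⟩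
    · rintro rfl
      exact hy' hxA'
    · rintro rfl
      exact hA.op_notMem hy
    · rintro rfl
      exact hx'A hy
    · rintro rfl
      exact hopx'A hy
  · rintro y ⟨hy, hy'⟩
    refine ⟨hA.nx_mem y hy, fun h => hy' ?_⟩
    rw [← S.nx_nx_nx y]
    exact hA'.nx_mem _ (hA'.nx_mem _ h)

/-- The branches growing at the leaves of a hull do not come back to it. -/
theorem IsLoopedTree.op_branch_notMem (hS : S.IsLoopedTree) (hW : S.IsHull W) {e : S.E}
    (he : e ∈ W) (h1 : S.op (S.nx e) ∉ W) (h2 : S.op (S.nx (S.nx e)) ∉ W) (w : List Bool)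
    (b : Bool) : S.op (S.branch e w b) ∉ W := by
  suffices h : ∃ A, S.IsHalfSpace (S.branch e w b) A ∧ W ⊆ A by
    obtain ⟨A, hA, hWA⟩ := h
    exact fun h => hA.op_notMem (hWA h)
  have base : ∀ x ∈ W, S.op x ∉ W → ∃ A, S.IsHalfSpace x A ∧ W ⊆ A := by
    intro x hx hxW
    obtain ⟨A, hA⟩ := hS.exists_halfSpace x fun hl => hxW (hW.loop_mem _ hl.op)
    exact ⟨A, hA, hW.connectedOn.subset_halfSpace hx hxW hA⟩
  have step : ∀ x x', (∃ A, S.IsHalfSpace x A ∧ W ⊆ A) → x' ∈ S.vtx (S.op x) → x' ≠ S.op x →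
      ∃ A, S.IsHalfSpace x' A ∧ W ⊆ A := by
    rintro x x' ⟨A, hA, hWA⟩ hx' hne
    have hx'A : x' ∉ A := fun h =>
      hA.op_notMem (mem_of_mem_vtx hA.nx_mem h (mem_vtx_comm.1 hx'))
    obtain ⟨A', hA'⟩ := hS.exists_halfSpace x' fun hl => hx'A (hWA (hW.loop_mem _ hl))
    exact ⟨A', hA', hWA.trans (hA.subset hS.noProperStable hA' hx' hne)⟩
  have hnn : ∀ x, S.nx (S.nx x) ≠ x := fun x h => hS.nx_ne x (by rw [← h, S.nx_nx_nx, h])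
  induction w generalizing b with
  | nil =>
    cases b
    · exact base _ (hW.nx_mem _ he) h1
    · exact base _ (hW.nx_mem _ (hW.nx_mem _ he)) h2
  | cons c w ih =>
    cases b
    · exact step _ _ (ih c) (Or.inr (Or.inl rfl)) (hS.nx_ne _)
    · exact step _ _ (ih c) (Or.inr (Or.inr rfl)) (hnn _)

theorem IsLoopedTree.op_nx_of_isLoop (hS : S.IsLoopedTree) {e z : S.E} (he : ¬ S.IsLoop e)
    (hz : z ∈ S.vtx e) (hl : S.IsLoop z) : S.op (S.nx e) = S.nx (S.nx e) := by
  have h1 : S.op z ∈ S.vtx e := mem_vtx_trans hl hz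
  have h2 : S.op z ≠ e := fun h => he (h ▸ hl.op)
  rcases hz with rfl | rfl | rfl
  · exact absurd hl he
  · rcases h1 with h | h | h
    · exact absurd h h2
    · exact absurd h (hS.op_ne _)
    · exact h
  · rcases h1 with h | h | h
    · exact absurd h h2
    · rw [← h, S.op_op, h]
    · exact absurd h (hS.op_ne _)

section

variable (hS : S.IsLoopedTree) (hW : S.IsHull W)
  (hred : ∀ x y, S.IsFreeLeaf W x → S.IsFreeLeaf W y → S.op y ∈ S.vtx (S.op x) → x = y)

theorem IsLoopedTree.pair_isPlain : (hS.pair hW hred).IsPlain := by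
  classical
  intro v
  by_cases h : ∃ e ∈ (v.1 : HullVertex S W).1, S.IsLoop e
  · exact Or.inl (if_pos h)
  · exact Or.inr (if_neg h)

/-- The end of a dart. -/
noncomputable def IsLoopedTree.dartEnd (d : (hS.pair hW hred).tree.graph.Dart) : S.inner W :=
  hS.dartEquiv.symm d

/-- The dart of an end. -/
noncomputable def IsLoopedTree.pairDart (e : S.inner W) :
    (hS.pair hW hred).tree.graph.Dart :=
  hullDart e

theorem IsLoopedTree.pairDart_surjective : Function.Surjective (hS.pairDart hW hred) :=
  hS.hullDart_bijective.2

theorem IsLoopedTree.dartEnd_pairDart (e : S.inner W) :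
    hS.dartEnd hW hred (hS.pairDart hW hred e) = e :=
  hS.dartEquiv.symm_apply_apply e

theorem IsLoopedTree.pairDart_symm (e : S.inner W) :
    (hS.pairDart hW hred e).symm = hS.pairDart hW hred (innerOp e) :=
  hullDart_symm e

theorem IsLoopedTree.rot_pairDart (e : S.inner W) (h : S.nx e ∈ S.inner W) :
    (hS.pair hW hred).tree.rot (hS.pairDart hW hred e) = hS.pairDart hW hred ⟨S.nx e, h⟩ :=
  (hS.rot_hullDart hW e).trans (congrArg _ (innerRot_of_mem _ _ _ h))

theorem IsLoopedTree.isLeaf_pairDart (e : S.inner W) :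
    (hS.pair hW hred).tree.IsLeaf (hS.pairDart hW hred e).fst ↔ S.nx e ∉ S.inner W :=
  hS.isLeaf_iff hW e

theorem IsLoopedTree.typ_eq_none_iff (d : (hS.pair hW hred).tree.graph.Dart) :
    (hS.pair hW hred).typ d = none ↔ S.nx (hS.dartEnd hW hred d) ∈ S.inner W := by
  obtain ⟨e, rfl⟩ := hS.pairDart_surjective hW hred d
  rw [hS.dartEnd_pairDart hW hred, typ_eq_none, hS.isLeaf_pairDart hW hred,
    not_not]

theorem IsLoopedTree.typ_eq_zero (d : (hS.pair hW hred).tree.graph.Dart)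
    (h : (hS.pair hW hred).typ d = some .zero) :
    S.op (S.nx (hS.dartEnd hW hred d)) = S.nx (S.nx (hS.dartEnd hW hred d)) := by
  classical
  obtain ⟨e, rfl⟩ := hS.pairDart_surjective hW hred d
  rw [hS.dartEnd_pairDart hW hred]
  unfold typ at h
  split_ifs at h with h'
  have h2 : ∃ z ∈ S.vtx e, S.IsLoop z := by
    by_contra hcon
    have h3 : (hS.pair hW hred).ell ⟨(hS.pairDart hW hred e).fst, h'⟩ = .triangle := if_neg hcon
    rw [h3] at h
    cases h
  obtain ⟨z, hz, hl⟩ := h2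
  exact hS.op_nx_of_isLoop e.2.2.2 hz hl

theorem IsLoopedTree.typ_eq_triangle (d : (hS.pair hW hred).tree.graph.Dart)
    (h : (hS.pair hW hred).typ d = some .triangle) :
    S.op (S.nx (hS.dartEnd hW hred d)) ∉ W ∧ S.op (S.nx (S.nx (hS.dartEnd hW hred d))) ∉ W := by
  classical
  have hnone := (hS.typ_eq_none_iff hW hred d).not.1 (by simp [h])
  obtain ⟨e, rfl⟩ := hS.pairDart_surjective hW hred d
  rw [hS.dartEnd_pairDart hW hred] at hnone ⊢
  unfold typ at h
  split_ifs at h with h'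
  have h2 : ∀ z ∈ S.vtx e, ¬ S.IsLoop z := by
    by_contra hcon
    push Not at hcon
    have h3 : (hS.pair hW hred).ell ⟨(hS.pairDart hW hred e).fst, h'⟩ = .zero := if_pos hcon
    rw [h3] at h
    cases h
  have key : ∀ z ∈ S.vtx e, z ≠ e → S.op z ∉ W := fun z hz hne hzW =>
    hne (hW.eq_of_nx_notMem e.2 hnone hz
      ⟨mem_of_mem_vtx hW.nx_mem e.2.1 hz, hzW, h2 z hz⟩)
  refine ⟨key _ (Or.inr (Or.inl rfl)) (hS.nx_ne _), key _ (Or.inr (Or.inr rfl)) fun h => ?_⟩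
  exact hS.nx_ne e.1 (by rw [← h, S.nx_nx_nx, h])

/-- The map from the skeleton of the pair of a hull. -/
noncomputable def IsLoopedTree.hullMap : (hS.pair hW hred).skeleton.E → S.E :=
  (hS.pair hW hred).extend S fun d => (hS.dartEnd hW hred d).1

theorem IsLoopedTree.hullMap_nx (x : (hS.pair hW hred).skeleton.E) :
    hS.hullMap hW hred ((hS.pair hW hred).skeleton.nx x) = S.nx (hS.hullMap hW hred x) := by
  refine (hS.pair_isPlain hW hred).extend_nx (fun d hd => ?_) x
  rw [hS.typ_eq_none_iff hW hred] at hd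
  obtain ⟨e, rfl⟩ := hS.pairDart_surjective hW hred d
  rw [hS.dartEnd_pairDart hW hred] at hd ⊢
  rw [hS.rot_pairDart hW hred e hd, hS.dartEnd_pairDart hW hred]

theorem IsLoopedTree.hullMap_op (x : (hS.pair hW hred).skeleton.E) :
    hS.hullMap hW hred ((hS.pair hW hred).skeleton.op x) = S.op (hS.hullMap hW hred x) := by
  by_cases hx : ∃ d h b, x = End.loop d h b
  · obtain ⟨d, h, b, rfl⟩ := hx
    have h1 := hS.typ_eq_zero hW hred d h
    cases b
    · exact h1.symm
    · change S.nx _ = S.op (S.nx (S.nx _))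
      rw [← h1, S.op_op]
  · push Not at hx
    refine (hS.pair_isPlain hW hred).extend_op (fun d => ?_) x hx
    obtain ⟨e, rfl⟩ := hS.pairDart_surjective hW hred d
    rw [hS.pairDart_symm hW hred, hS.dartEnd_pairDart hW hred, hS.dartEnd_pairDart hW hred]
    rfl

theorem IsLoopedTree.eq_loop_of_isLoop_hullMap (x : (hS.pair hW hred).skeleton.E)
    (hx : S.IsLoop (hS.hullMap hW hred x)) : ∃ d h b, x = End.loop d h b := by
  have hbr : ∀ d, (hS.pair hW hred).typ d = some .triangle → ∀ w b,
      S.op (S.branch (hS.dartEnd hW hred d).1 w b) ∉ W := fun d h =>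
    hS.op_branch_notMem hW (hS.dartEnd hW hred d).2.1 (hS.typ_eq_triangle hW hred d h).1
      (hS.typ_eq_triangle hW hred d h).2
  rcases x with ⟨d, h⟩ | ⟨d, h, b⟩ | ⟨d, h, w, b⟩ | ⟨d, h, w, b⟩
  · exact absurd hx (hS.dartEnd hW hred d).2.2.2
  · exact ⟨d, h, b, rfl⟩
  · exact absurd (hW.loop_mem _ hx.op) (hbr d h w b)
  · exact absurd (hW.loop_mem _ hx) (hbr d h w b)

theorem IsLoopedTree.op_eq_of_hullMap (x : (hS.pair hW hred).skeleton.E)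
    (hx : S.op (hS.hullMap hW hred x) = S.nx (S.nx (hS.hullMap hW hred x))) :
    (hS.pair hW hred).skeleton.op x =
      (hS.pair hW hred).skeleton.nx ((hS.pair hW hred).skeleton.nx x) := by
  obtain ⟨d, h, b, rfl⟩ := hS.eq_loop_of_isLoop_hullMap hW hred x (Or.inr (Or.inr hx))
  cases b
  · exfalso
    have h1 := hS.typ_eq_zero hW hred d h
    exact hS.nx_ne _ (hx.symm.trans h1)
  · exact ((hS.pair hW hred).nx_zero d _ h).symm

theorem IsLoopedTree.noProperStable_pair : (hS.pair hW hred).skeleton.NoProperStable := by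
  intro A hne hop hnx
  have hP := hS.pair_isPlain hW hred
  have hcast : ∀ d d' : (hS.pair hW hred).tree.graph.Dart, d = d' → ∀ h h',
      End.edge (P := hS.pair hW hred) d h ∈ A → End.edge (P := hS.pair hW hred) d' h' ∈ A := by
    rintro d _ rfl h h' hA
    exact hA
  let B : Set (S.inner W) := {e | End.edge (P := hS.pair hW hred) (hS.pairDart hW hred e)
    (hP.typ_ne_white _) ∈ A}
  have hBop : ∀ e ∈ B, innerOp e ∈ B := by
    intro e he
    have h1 := hop _ he
    rw [hP.op_edge] at h1
    exact hcast _ _ (hS.pairDart_symm hW hred e) _ _ h1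
  have hBnx : ∀ e ∈ B, ∀ h : S.nx e ∈ S.inner W, ⟨S.nx e, h⟩ ∈ B := by
    intro e he h
    have h1 := hnx _ he
    have h2 : (hS.pair hW hred).typ (hS.pairDart hW hred e) = none := by
      rw [hS.typ_eq_none_iff hW hred, hS.dartEnd_pairDart hW hred]
      exact h
    rw [show (hS.pair hW hred).skeleton.nx (.edge _ _) = _ from nx_node _ _ _ h2] at h1
    exact hcast _ _ (hS.rot_pairDart hW hred e h) _ _ h1
  have hBvtx : ∀ e ∈ B, ∀ z : S.inner W, z.1 ∈ S.vtx e → z ∈ B := by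
    intro e he z hz
    rcases hz with hz | hz | hz
    · rwa [Subtype.ext hz]
    · have := hBnx e he (hz ▸ z.2)
      rwa [show z = ⟨S.nx e, hz ▸ z.2⟩ from Subtype.ext hz]
    · have hne : S.nx (S.nx e) ≠ e := fun h => hS.nx_ne e.1 (by rw [← h, S.nx_nx_nx, h])
      have h1 : S.nx e ∈ S.inner W :=
        hW.trivalent e e.2 z z.2 (Or.inr (Or.inr hz)) (hz ▸ hne) _ (Or.inr (Or.inl rfl))
      have := hBnx _ (hBnx e he h1) (hz ▸ z.2)
      rwa [show z = ⟨S.nx (S.nx e), hz ▸ z.2⟩ from Subtype.ext hz]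
  let K : Set S.E := {x | ∃ z ∈ B, z.1 ∈ S.vtx x}
  have hBall : ∀ e, e ∈ B := by
    obtain ⟨d, h, hd⟩ := exists_edge_mem _ hne hop hnx
    obtain ⟨e₀, rfl⟩ := hS.pairDart_surjective hW hred d
    intro e
    have hK : e.1 ∈ K := by
      refine hW.connectedOn K ?_ ?_ e₀.1 e₀.2.1 e.1 e.2.1 ⟨e₀, hd, S.mem_vtx_self _⟩
      · rintro x - ⟨z, hz, hzx⟩
        exact ⟨z, hz, by rwa [vtx_nx]⟩
      · rintro x hx hx' ⟨z, hz, hzx⟩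
        by_cases hl : S.IsLoop x
        · exact ⟨z, hz, mem_vtx_trans hzx (mem_vtx_comm.1 hl)⟩
        · have h1 := hBvtx z hz ⟨x, hx, hx', hl⟩ (mem_vtx_comm.1 hzx)
          exact ⟨_, hBop _ h1, S.mem_vtx_self _⟩
    obtain ⟨z, hz, hze⟩ := hK
    exact hBvtx z hz e (mem_vtx_comm.1 hze)
  refine IsPlain.mem_of_edge_mem hop hnx fun d h => ?_
  obtain ⟨e, rfl⟩ := hS.pairDart_surjective hW hred d
  exact hBall e

theorem IsLoopedTree.hullMap_surjective : Function.Surjective (hS.hullMap hW hred) := by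
  refine hS.noProperStable (Set.range (hS.hullMap hW hred)) ?_ ?_ ?_
  · obtain ⟨e, he⟩ := hW.nonempty
    obtain ⟨x, -, hx⟩ := hW.exists_inner e he
    exact ⟨_, End.edge (hS.pairDart hW hred ⟨x, hx⟩) ((hS.pair_isPlain hW hred).typ_ne_white _), rfl⟩
  · rintro _ ⟨x, rfl⟩
    exact ⟨_, hS.hullMap_op hW hred x⟩
  · rintro _ ⟨x, rfl⟩
    exact ⟨_, hS.hullMap_nx hW hred x⟩

end

end RibbonGraph31

namespace cosetSkeleton

open ModularGrp RibbonGraph31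

theorem exists_iso_of_closure_eq {H : Subgroup ModularGrp} (htop : H ≠ ⊤) (hfg : H.FG)
    (h : Subgroup.closure ((H : Set ModularGrp) ∩ conjugatesOf (X * Y)) = H) :
    ∃ P : AdmissiblePair, P.IsPlain ∧ Nonempty ((cosetSkeleton H).Iso P.skeleton) := by
  obtain ⟨t, ht, hS⟩ := isLoopedTree_of_closure_eq htop hfg h
  obtain ⟨W, hW, hred⟩ := hS.exists_reduced_isHull
  obtain ⟨p, hp⟩ := hS.hullMap_surjective hW hred (coset H 1)
  obtain ⟨σ, -, hop, hnx, hπ⟩ := exists_section ht (hS.pair hW hred).skeleton (hS.hullMap hW hred)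
    (hS.hullMap_op hW hred) (hS.hullMap_nx hW hred)
    (fun g hg x hx => hS.op_eq_of_hullMap hW hred x (by rw [hx]; exact op_eq_nx_nx ht hg)) p hp
  have hsurj : Function.Surjective σ := by
    refine hS.noProperStable_pair hW hred (Set.range σ) ⟨_, coset H 1, rfl⟩ ?_ ?_
    · rintro _ ⟨e, rfl⟩
      exact ⟨_, hop e⟩
    · rintro _ ⟨e, rfl⟩
      exact ⟨_, hnx e⟩
  exact ⟨hS.pair hW hred, hS.pair_isPlain hW hred,
    ⟨Equiv.ofBijective σ ⟨Function.LeftInverse.injective hπ, hsurj⟩, hop, hnx⟩⟩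

end cosetSkeleton

/-! ## Potentials on trees -/

/-- Every cocycle on a tree is a coboundary. -/
theorem SimpleGraph.IsTree.exists_potential {V G : Type*} [Group G] {T : SimpleGraph V}
    (hT : T.IsTree) (c : T.Dart → G) (hc : ∀ d, c d.symm = (c d)⁻¹) :
    ∃ f : V → G, ∀ d : T.Dart, f d.snd = c d * f d.fst := by
  obtain ⟨r⟩ := hT.1.nonempty
  have hpath : ∀ v, ∃ p : T.Walk r v, p.IsPath := fun v => (hT.existsUnique_path r v).exists
  choose p hp using hpath
  have hconcat : ∀ (v w : V) (h : T.Adj v w), v ∈ (p w).support →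
      ((p w).darts.map c).reverse.prod = c ⟨(v, w), h⟩ * ((p v).darts.map c).reverse.prod := by
    intro v w h hv
    rw [hT.isAcyclic.path_concat (hp v) (hp w) h hv, Walk.darts_concat]
    simp
  refine ⟨fun v => ((p v).darts.map c).reverse.prod, fun d => ?_⟩
  by_cases hv : d.fst ∈ (p d.snd).support
  · exact hconcat _ _ d.adj hv
  · have hw := hT.isAcyclic.mem_support_of_ne_mem_support_of_adj_of_isPath (hp d.fst) (hp d.snd)
      d.adj hv
    change ((p d.snd).darts.map c).reverse.prod = c d * ((p d.fst).darts.map c).reverse.prod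
    rw [hconcat _ _ d.adj.symm hw]
    have : c ⟨(d.snd, d.fst), d.adj.symm⟩ = (c d)⁻¹ := hc d
    rw [this, mul_inv_cancel_left]

namespace ModularGrp

theorem X_ne_one : X ≠ 1 := by
  intro h
  obtain ⟨f, hX, -⟩ := exists_hom (Multiplicative.ofAdd (1 : ZMod 3)) 1 (by decide) (by decide)
  rw [h, map_one] at hX
  revert hX
  decide

/-- The action of the modular group on itself as a ribbon graph. -/
def regular : RibbonGraph31 where
  E := ModularGrp
  op g := Y * g
  nx g := X⁻¹ * g
  op_op g := by rw [← mul_assoc, Y_mul_Y, one_mul]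
  nx_nx_nx g := by
    rw [← mul_assoc, ← mul_assoc, ← mul_inv_rev, ← mul_inv_rev, X_mul_X_mul_X, inv_one, one_mul]

end ModularGrp

open ModularGrp RibbonGraph31

/-- The angles of the edge ends at the vertices of an admissible tree. -/
theorem AdmissibleTree.exists_angle (T : AdmissibleTree) : ∃ a : T.graph.Dart → ModularGrp,
    ∀ d, ¬ T.IsLeaf d.fst → a (T.rot d) = X⁻¹ * a d := by
  classical
  have := T.finite
  have := Fintype.ofFinite T.V
  have href : ∀ v : {v // ∃ d : T.graph.Dart, d.fst = v}, ∃ d : T.graph.Dart, d.fst = v := fun v => v.2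
  choose r hr using href
  have hk : ∀ d : T.graph.Dart, ∃ k : ℤ, (T.rot ^ k) (r ⟨d.fst, d, rfl⟩) = d := fun d =>
    (T.rot_cycle d.fst).2 (hr ⟨d.fst, d, rfl⟩) rfl
  choose k hk using hk
  refine ⟨fun d => X ^ (-k d), fun d hd => ?_⟩
  have hfst : (⟨(T.rot d).fst, T.rot d, rfl⟩ : {v // ∃ d : T.graph.Dart, d.fst = v}) =
      ⟨d.fst, d, rfl⟩ := Subtype.ext (T.rot_fst d)
  have h1 : (T.rot ^ k (T.rot d)) (r ⟨d.fst, d, rfl⟩) =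
      (T.rot ^ (1 + k d)) (r ⟨d.fst, d, rfl⟩) := by
    rw [zpow_add, Equiv.Perm.mul_apply, hk d, zpow_one, ← hfst]
    exact hk (T.rot d)
  let s : Finset T.graph.Dart := Finset.univ.filter fun d' => d'.fst = d.fst
  have hs : T.rot.IsCycleOn (s : Set T.graph.Dart) := by
    simpa [s] using T.rot_cycle d.fst
  have hcard : s.card = 3 := by
    have h3 := (T.valency d.fst).resolve_right hd
    have := T.graph.dart_fst_fiber_card_eq_degree d.fst
    rw [← SimpleGraph.card_neighborSet_eq_degree, ← Nat.card_eq_fintype_card,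
      Nat.card_coe_set_eq, h3] at this
    exact this
  have h2 := (hs.zpow_apply_eq_zpow_apply (by simp [s, hr])).1 h1
  rw [hcard] at h2
  have h3 : X ^ k (T.rot d) = X ^ (1 + k d) :=
    zpow_eq_zpow_iff_modEq.2 (h2.of_dvd (Int.natCast_dvd_natCast.2
      (orderOf_dvd_of_pow_eq_one X_pow_three)))
  change X ^ (-k (T.rot d)) = X⁻¹ * X ^ (-k d)
  rw [zpow_neg, zpow_neg, h3, add_comm, zpow_add, zpow_one, mul_inv_rev]

namespace AdmissiblePair

variable {P : AdmissiblePair}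

/-- The developing map of the skeleton of an admissible pair with its loops cut. -/
theorem IsPlain.exists_developing (hP : P.IsPlain) : ∃ s : P.skeleton.E → ModularGrp,
    (∀ x, s (P.skeleton.nx x) = X⁻¹ * s x) ∧
    ∀ x, (∀ d h b, x ≠ .loop d h b) → s (P.skeleton.op x) = Y * s x := by
  obtain ⟨a, ha⟩ := P.tree.exists_angle
  obtain ⟨f, hf⟩ := P.tree.isTree.exists_potential (fun d => (a d.symm)⁻¹ * Y * a d) (by
    intro d
    simp [mul_assoc, Y_inv])
  let g : P.tree.graph.Dart → regular.E := fun d => (a d * f d.fst : ModularGrp)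
  refine ⟨P.extend regular g, hP.extend_nx (g := g) (R := regular) fun d hd => ?_,
    hP.extend_op (g := g) (R := regular) fun d => ?_⟩
  · change a (P.tree.rot d) * f (P.tree.rot d).fst = X⁻¹ * (a d * f d.fst)
    rw [ha d (typ_eq_none.1 hd), P.tree.rot_fst, mul_assoc]
  · change a d.symm * f d.snd = Y * (a d * f d.fst)
    rw [hf]
    simp only [mul_assoc, mul_inv_cancel_left]

theorem IsPlain.noMonovalent (hP : P.IsPlain) : P.skeleton.NoMonovalent := by
  intro x
  constructor
  · rcases x with ⟨d, h⟩ | ⟨d, h, b⟩ | ⟨d, h, w, b⟩ | ⟨d, h, w, b⟩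
    · rw [hP.op_edge]
      intro h'
      exact d.symm_ne (End.edge.inj h')
    · intro h'
      have := (End.loop.inj h').2
      simp at this
    · intro h'
      cases h'
    · intro h'
      cases h'
  · intro h
    obtain ⟨s, hs, -⟩ := hP.exists_developing
    have := hs x
    rw [h] at this
    exact X_ne_one (by simpa using this)

open Classical in
theorem isPlain_of_noMonovalent (h : P.skeleton.NoMonovalent) (hne : Nonempty P.skeleton.E) :
    P.IsPlain := by
  rintro ⟨v, hv⟩
  have hu : (P.tree.graph.neighborSet v).ncard = 1 := hv
  obtain ⟨u, hu⟩ := Set.ncard_eq_one.1 hu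
  have huv : P.tree.graph.Adj v u := by
    change u ∈ P.tree.graph.neighborSet v
    rw [hu]
    rfl
  let d : P.tree.graph.Dart := ⟨(v, u), huv⟩
  have hd : P.typ d = some (P.ell ⟨v, hv⟩) := dif_pos hv
  match ht : P.ell ⟨v, hv⟩ with
  | .zero => exact Or.inl rfl
  | .triangle => exact Or.inr rfl
  | .black =>
    rw [ht] at hd
    exact absurd (P.nx_black d (by simp [hd]) hd) (h (.edge d (by simp [hd]))).2
  | .white =>
    exfalso
    rw [ht] at hd
    have hd' : P.typ d.symm = some .white := by
      by_contra hcon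
      exact (h (.edge d.symm hcon)).1 (dif_pos hd)
    have hleaf : P.tree.IsLeaf u := by
      by_contra hcon
      rw [typ_eq_none.2 hcon] at hd'
      cases hd'
    obtain ⟨v', hv'⟩ := Set.ncard_eq_one.1 hleaf
    have hvv' : v = v' := by
      have : v ∈ P.tree.graph.neighborSet u := huv.symm
      rwa [hv'] at this
    obtain ⟨d₀, hd₀, -⟩ := P.exists_edge_mem (A := Set.univ) Set.univ_nonempty
      (fun _ _ => trivial) (fun _ _ => trivial)
    have key : ∀ {a b : P.tree.V} (p : P.tree.graph.Walk a b), a = v ∨ a = u → b = v ∨ b = u := by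
      intro a b p
      induction p with
      | nil => exact id
      | @cons a b c hab p ih =>
        rintro (rfl | rfl)
        · refine ih (Or.inr ?_)
          have : b ∈ P.tree.graph.neighborSet a := hab
          rwa [hu] at this
        · refine ih (Or.inl ?_)
          have : b ∈ P.tree.graph.neighborSet a := hab
          rw [hv'] at this
          exact this.trans hvv'.symm
    obtain ⟨p⟩ := P.tree.isTree.1.preconnected v d₀.fst
    have htyp : ∀ d' : P.tree.graph.Dart, d'.fst = d₀.fst → P.typ d' = P.typ d₀ := by
      intro d' h'
      have : ∀ a b, a = b → (if h : P.tree.IsLeaf a then some (P.ell ⟨a, h⟩) else none) =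
          if h : P.tree.IsLeaf b then some (P.ell ⟨b, h⟩) else none := by
        rintro a _ rfl
        rfl
      exact this _ _ h'
    rcases key p (Or.inl rfl) with h' | h'
    · exact hd₀ ((htyp d h'.symm).symm.trans hd)
    · exact hd₀ ((htyp d.symm h'.symm).symm.trans hd')

end AdmissiblePair

theorem RibbonGraph31.Iso.noMonovalent_iff {S S' : RibbonGraph31} (φ : S.Iso S') :
    S.NoMonovalent ↔ S'.NoMonovalent := by
  constructor
  · intro h e
    obtain ⟨e, rfl⟩ := φ.toEquiv.surjective e
    rw [← φ.map_op, ← φ.map_nx, φ.toEquiv.injective.ne_iff, φ.toEquiv.injective.ne_iff]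
    exact h e
  · intro h e
    rw [← φ.toEquiv.injective.ne_iff, ← φ.toEquiv.injective.ne_iff (x := S.nx e), φ.map_op,
      φ.map_nx]
    exact h _

/-! ## Free bases -/

namespace RibbonGraph31

/-- The covering with voltages given by the function `ξ` of the ends. -/
def voltage (S : RibbonGraph31) {F : Type} [Group F] (ξ : S.E → F) : RibbonGraph31 where
  E := S.E × F
  op x := (S.op x.1, ξ (S.op x.1) * (ξ x.1)⁻¹ * x.2)
  nx x := (S.nx x.1, x.2)
  op_op x := by
    ext
    · exact S.op_op _
    · simp [S.op_op, mul_assoc]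
  nx_nx_nx x := by simp [S.nx_nx_nx]

end RibbonGraph31

namespace cosetSkeleton

open ModularGrp RibbonGraph31

variable {H : Subgroup ModularGrp}

/-- A subgroup whose skeleton can be developed after its loops are cut has a free basis given by
the loops. -/
theorem exists_freeGroupBasis (hnx₀ : ∀ e, (cosetSkeleton H).nx e ≠ e)
    (s : (cosetSkeleton H).E → ModularGrp) (hs₁ : s (coset H 1) = 1)
    (hsnx : ∀ e, s ((cosetSkeleton H).nx e) = X⁻¹ * s e)
    (hsop : ∀ e, (cosetSkeleton H).op e ≠ (cosetSkeleton H).nx e →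
      (cosetSkeleton H).op e ≠ (cosetSkeleton H).nx ((cosetSkeleton H).nx e) →
      s ((cosetSkeleton H).op e) = Y * s e) :
    ∃ (ι : Type) (b : FreeGroupBasis ι H), (∀ i, IsConj (X * Y) (b i : ModularGrp)) ∧
      Subgroup.closure (Set.range fun i => (b i : ModularGrp)) = H := by
  classical
  let S := cosetSkeleton H
  let ι : Type := {e : S.E // S.op e = S.nx (S.nx e)}
  let ξ : S.E → FreeGroup ι := fun e =>
    if h : S.op e = S.nx (S.nx e) then FreeGroup.of ⟨e, h⟩ else 1
  obtain ⟨f, hX, hY, hfst⟩ : ∃ f : ModularGrp →* Equiv.Perm (S.E × FreeGroup ι),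
      (∀ e a, f X (e, a) = (S.nx (S.nx e), a)) ∧
      (∀ e a, f Y (e, a) = (S.op e, ξ (S.op e) * (ξ e)⁻¹ * a)) ∧
      ∀ (g a : ModularGrp) (x : S.E × FreeGroup ι), x.1 = coset H a →
        (f g x).1 = coset H (g * a) := by
    obtain ⟨f, hX, hY⟩ := (S.voltage ξ).exists_action
    exact ⟨f, fun e a => hX (e, a), fun e a => hY (e, a), fun g a x hx =>
      map_action (H := H) hX hY (π := Prod.fst) (fun _ => rfl) (fun _ => rfl) g x a hx⟩
  have hright : ∀ (g : ModularGrp) (e : S.E) (a b : FreeGroup ι),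
      f g (e, a * b) = ((f g (e, a)).1, (f g (e, a)).2 * b) := by
    intro g
    have hg : g ∈ Subgroup.closure {X, Y} := by rw [closure_X_Y]; trivial
    induction hg using Subgroup.closure_induction with
    | mem g hg =>
      rcases hg with rfl | rfl
      · intro e a b
        rw [hX, hX]
      · intro e a b
        rw [hY, hY, mul_assoc _ _ b]
    | one =>
      intro e a b
      rw [map_one]
      rfl
    | mul g g' _ _ h h' =>
      intro e a b
      rw [map_mul, Equiv.Perm.mul_apply, Equiv.Perm.mul_apply, h', h]
    | inv g _ h =>
      intro e a b
      apply (f g).injective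
      rw [h, ← Equiv.Perm.mul_apply, ← Equiv.Perm.mul_apply, ← map_mul, mul_inv_cancel, map_one]
      rfl
  have hdevnx : ∀ e, f (s e) (coset H 1, 1) = (e, 1) →
      f (s (S.nx e)) (coset H 1, 1) = (S.nx e, 1) := by
    intro e he
    rw [hsnx, map_mul, Equiv.Perm.mul_apply, he, X_inv, map_mul, Equiv.Perm.mul_apply, hX, hX]
    rw [S.nx_nx_nx]
  have hdev : ∀ e, f (s e) (coset H 1, 1) = (e, 1) := by
    refine noProperStable H {e | f (s e) (coset H 1, 1) = (e, 1)} ⟨coset H 1, ?_⟩ ?_ ?_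
    · change f (s (coset H 1)) _ = _
      rw [hs₁, map_one]
      rfl
    · intro e he
      change f (s (S.op e)) _ = _
      by_cases h1 : S.op e = S.nx e
      · rw [h1]
        exact hdevnx e he
      by_cases h2 : S.op e = S.nx (S.nx e)
      · rw [h2]
        exact hdevnx _ (hdevnx e he)
      rw [hsop e h1 h2, map_mul, Equiv.Perm.mul_apply, he, hY]
      have h3 : ¬ S.op (S.op e) = S.nx (S.nx (S.op e)) := by
        intro h
        apply h1
        rw [S.op_op] at h
        rw [← S.nx_nx_nx (S.op e), ← h]
      refine Prod.ext rfl ?_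
      change ξ (S.op e) * (ξ e)⁻¹ * 1 = 1
      simp only [ξ, h2, h3, dif_neg, not_false_eq_true, inv_one, mul_one]
    · exact hdevnx
  let φ : ι → ModularGrp := fun i => (s i.1)⁻¹ * (Y * X) * s i.1
  have hφ : ∀ i, f (φ i) (coset H 1, 1) = (coset H 1, FreeGroup.of i) := by
    intro i
    have h1 : ¬ S.op (S.op i.1) = S.nx (S.nx (S.op i.1)) := by
      intro h
      rw [S.op_op, i.2, S.nx_nx_nx] at h
      exact hnx₀ _ h.symm
    have h2 : f (Y * X) (i.1, 1) = (i.1, FreeGroup.of i) := by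
      rw [map_mul, Equiv.Perm.mul_apply, hX, hY]
      have h3 : ξ (S.op i.1) = 1 := dif_neg h1
      have h4 : ξ i.1 = FreeGroup.of i := dif_pos i.2
      rw [← i.2, S.op_op, h3, h4, inv_one, mul_one, mul_one]
    have h3 : f (s i.1) (coset H 1, FreeGroup.of i) = (i.1, FreeGroup.of i) := by
      have := hright (s i.1) (coset H 1) 1 (FreeGroup.of i)
      rwa [hdev, one_mul] at this
    rw [map_mul f _ (s i.1), map_mul f (s i.1)⁻¹, Equiv.Perm.mul_apply, Equiv.Perm.mul_apply, hdev, h2, ← h3, ← Equiv.Perm.mul_apply, ← map_mul, inv_mul_cancel, map_one]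
    rfl
  have hmem : ∀ g, (f g (coset H 1, 1)).1 = coset H 1 ↔ g ∈ H := by
    intro g
    rw [hfst g 1 _ rfl, mul_one, eq_comm, coset_eq_iff, inv_one, one_mul]
  have hφH : ∀ i, φ i ∈ H := fun i => (hmem _).1 (by rw [hφ])
  let ψ : H →* FreeGroup ι :=
    { toFun := fun h => (f h (coset H 1, 1)).2
      map_one' := by
        change (f 1 (coset H 1, 1)).2 = 1
        rw [map_one]
        rfl
      map_mul' := by
        intro h h'
        have h1 : f h' (coset H 1, 1) = (coset H 1, 1 * (f h' (coset H 1, 1)).2) :=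
          Prod.ext ((hmem _).2 h'.2) (one_mul _).symm
        rw [Subgroup.coe_mul, map_mul, Equiv.Perm.mul_apply, h1, hright, one_mul] }
  let Φ : FreeGroup ι →* H := FreeGroup.lift fun i => ⟨φ i, hφH i⟩
  have hψΦ : ∀ w, ψ (Φ w) = w := by
    intro w
    have : ψ.comp Φ = MonoidHom.id _ := by
      ext i
      simp only [MonoidHom.comp_apply, Φ, FreeGroup.lift_apply_of]
      exact congrArg Prod.snd (hφ i)
    exact DFunLike.congr_fun this w
  have hgen : ∀ g a : ModularGrp, (s (coset H (g * a)))⁻¹ * g * s (coset H a) ∈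
      Subgroup.closure (Set.range φ) := by
    intro g
    have hg : g ∈ Subgroup.closure {X, Y} := by rw [closure_X_Y]; trivial
    induction hg using Subgroup.closure_induction with
    | mem g hg =>
      intro a
      rcases hg with rfl | rfl
      · have h1 := hsnx (coset H (X * a))
        rw [nx_mk, inv_mul_cancel_left] at h1
        rw [h1, mul_assoc, mul_inv_cancel_left, inv_mul_cancel]
        exact one_mem _
      · rw [← op_mk]
        by_cases h1 : S.op (coset H a) = S.nx (coset H a)
        · have h2 : S.op (S.op (coset H a)) = S.nx (S.nx (S.op (coset H a))) := by
            rw [S.op_op, h1, S.nx_nx_nx]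
          have h3 : s (coset H a) = X * s (S.op (coset H a)) := by
            rw [h1, hsnx, mul_inv_cancel_left]
          refine Subgroup.subset_closure ⟨⟨_, h2⟩, ?_⟩
          rw [h3]
          simp only [φ, mul_assoc]
          rfl
        by_cases h2 : S.op (coset H a) = S.nx (S.nx (coset H a))
        · have h3 : s (S.op (coset H a)) = X * s (coset H a) := by
            rw [h2, hsnx, hsnx, ← mul_assoc, ← mul_inv_rev, ← X_inv, inv_inv]
          rw [← inv_mem_iff]
          refine Subgroup.subset_closure ⟨⟨_, h2⟩, ?_⟩
          change _ = ((s (S.op (coset H a)))⁻¹ * Y * s (coset H a))⁻¹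
          rw [h3]
          simp only [φ, mul_inv_rev, inv_inv, Y_inv, mul_assoc]
        · rw [hsop _ h1 h2, mul_assoc, inv_mul_cancel]
          exact one_mem _
    | one =>
      intro a
      rw [one_mul, mul_one, inv_mul_cancel]
      exact one_mem _
    | mul g g' _ _ h h' =>
      intro a
      have h1 := mul_mem (h (g' * a)) (h' a)
      rw [← mul_assoc g g' a] at h1
      convert h1 using 1
      group
    | inv g _ h =>
      intro a
      have h1 := inv_mem (h (g⁻¹ * a))
      rw [mul_inv_cancel_left] at h1
      convert h1 using 1
      group
  have hclosure : Subgroup.closure (Set.range φ) = H := by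
    refine le_antisymm ((Subgroup.closure_le _).2 ?_) fun g hg => ?_
    · rintro _ ⟨i, rfl⟩
      exact hφH i
    · have h1 := hgen g 1
      have h2 : coset H (g * 1) = coset H 1 := by
        rw [mul_one, eq_comm, coset_eq_iff, inv_one, one_mul]
        exact hg
      rwa [h2, hs₁, inv_one, one_mul, mul_one] at h1
  have hsurj : Function.Surjective Φ := by
    have h1 : Subgroup.closure (Set.range φ) ≤ (H.subtype.comp Φ).range := by
      rw [Subgroup.closure_le]
      rintro _ ⟨i, rfl⟩
      exact ⟨FreeGroup.of i, by simp [Φ]⟩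
    rintro ⟨h, hh⟩
    obtain ⟨w, hw⟩ := h1 (hclosure.symm ▸ hh)
    exact ⟨w, Subtype.ext hw⟩
  let b : FreeGroupBasis ι H := FreeGroupBasis.ofRepr
    (MulEquiv.ofBijective Φ ⟨Function.LeftInverse.injective hψΦ, hsurj⟩).symm
  have hb : ∀ i, (b i : ModularGrp) = φ i := by
    intro i
    change ((Φ (FreeGroup.of i) : H) : ModularGrp) = φ i
    simp [Φ]
  refine ⟨ι, b, fun i => ?_, ?_⟩
  · rw [hb, isConj_iff]
    refine ⟨(s i.1)⁻¹ * Y, ?_⟩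
    have h1 : ∀ a : ModularGrp, Y * (Y * a) = a := fun a => by rw [← mul_assoc, Y_mul_Y, one_mul]
    simp only [φ, mul_inv_rev, inv_inv, Y_inv, mul_assoc, h1]
  · simp only [hb]
    exact hclosure

/-- The skeleton of a pair with values in `{0, △}` gives a free basis. -/
theorem exists_freeGroupBasis_of_iso {P : AdmissiblePair} (hP : P.IsPlain)
    (φ : (cosetSkeleton H).Iso P.skeleton) :
    ∃ (ι : Type) (b : FreeGroupBasis ι H), (∀ i, IsConj (X * Y) (b i : ModularGrp)) ∧
      Subgroup.closure (Set.range fun i => (b i : ModularGrp)) = H := by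
  obtain ⟨s, hnx, hop⟩ := hP.exists_developing
  refine exists_freeGroupBasis (fun e => ((φ.noMonovalent_iff.2 hP.noMonovalent) e).2)
    (fun e => s (φ.toEquiv e) * (s (φ.toEquiv (coset H 1)))⁻¹) (mul_inv_cancel _) ?_ ?_
  · intro e
    rw [φ.map_nx, hnx, mul_assoc]
  · intro e h1 h2
    rw [φ.map_op, hop, mul_assoc]
    rintro d h b he
    rw [← φ.toEquiv.injective.ne_iff, φ.map_op, φ.map_nx] at h1 h2
    rw [φ.map_nx] at h2
    rw [he] at h1 h2
    cases b
    · exact h1 rfl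
    · exact h2 (P.nx_zero d _ h).symm

end cosetSkeleton

theorem proposition4p3 (H : Subgroup ModularGrp) (hproper : H ≠ ⊤) (hfg : H.FG) :
    -- `H` is generated by the conjugates of `𝕏𝕐` in it iff `Γ/H` is a generalized pseudo-tree
    -- without monovalent vertices,
    (Subgroup.closure ((H : Set ModularGrp) ∩ conjugatesOf (ModularGrp.X * ModularGrp.Y)) = H ↔
      (cosetSkeleton H).IsGeneralizedPseudoTree ∧ (cosetSkeleton H).NoMonovalent) ∧
    -- the latter means that `Γ/H` is the skeleton of a pair `(T, ℓ)` with `ℓ` valued in `{0, △}`,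
    ((cosetSkeleton H).IsGeneralizedPseudoTree ∧ (cosetSkeleton H).NoMonovalent ↔
      ∃ P : AdmissiblePair, (∀ v, P.ell v = LeafType.zero ∨ P.ell v = LeafType.triangle) ∧
        Nonempty ((cosetSkeleton H).Iso P.skeleton)) ∧
    -- and in this case `H` has a free basis consisting of conjugates of `𝕏𝕐`.
    ((cosetSkeleton H).IsGeneralizedPseudoTree ∧ (cosetSkeleton H).NoMonovalent →
      ∃ (ι : Type) (b : FreeGroupBasis ι H),
        ∀ i, IsConj (ModularGrp.X * ModularGrp.Y) (b i : ModularGrp)) := by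
  have hplain : (cosetSkeleton H).IsGeneralizedPseudoTree ∧ (cosetSkeleton H).NoMonovalent ↔
      ∃ P : AdmissiblePair, P.IsPlain ∧ Nonempty ((cosetSkeleton H).Iso P.skeleton) := by
    constructor
    · rintro ⟨⟨⟨⟨e⟩, -⟩, P, ⟨φ⟩⟩, hmono⟩
      exact ⟨P, AdmissiblePair.isPlain_of_noMonovalent (φ.noMonovalent_iff.1 hmono)
        ⟨φ.toEquiv e⟩, ⟨φ⟩⟩
    · rintro ⟨P, hP, ⟨φ⟩⟩
      exact ⟨⟨cosetSkeleton.isSkeleton H, P, ⟨φ⟩⟩, φ.noMonovalent_iff.2 hP.noMonovalent⟩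
  refine ⟨⟨fun h => hplain.2 (cosetSkeleton.exists_iso_of_closure_eq hproper hfg h), fun h => ?_⟩,
    hplain, fun h => ?_⟩
  · obtain ⟨P, hP, ⟨φ⟩⟩ := hplain.1 h
    obtain ⟨ι, b, hb, hgen⟩ := cosetSkeleton.exists_freeGroupBasis_of_iso hP φ
    refine le_antisymm ((Subgroup.closure_le _).2 fun g hg => hg.1) ?_
    conv_lhs => rw [← hgen]
    refine Subgroup.closure_mono ?_
    rintro _ ⟨i, rfl⟩
    exact ⟨(b i).2, hb i⟩
  · obtain ⟨P, hP, ⟨φ⟩⟩ := hplain.1 h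
    obtain ⟨ι, b, hb, -⟩ := cosetSkeleton.exists_freeGroupBasis_of_iso hP φ
    exact ⟨ι, b, hb⟩
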